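/- Let $d\ge 2$ and let $\{(S^x_n)_{n\ge 0} : x\in\mathbb Z^d\}$ be independent simple random walks on $\mathbb Z^d$ with $S^x_0=x$ (nearest-neighbour steps $\pm e_i$, each with probability $1/(2d)$). Put $t(x,z)=\min\{n\ge 0 : S^x_n=z\}$ (with $t(x,z)=\infty$ if $z$ is never visited), and let $$T(x,z)=\inf\Big\{\sum_{i=1}^k t(x_{i-1},x_i) : k\ge 0,\ x_0,\dots,x_k\in\mathbb Z^d,\ x_0=x,\ x_k=z\Big\}$$ be the passage time from $x$ to $z$ of the frog model with one particle per site. Then there is a constant $\gamma>0$, depending only on $d$, such that for every $x_0\in\mathbb Z^d$ there is a finite constant $C=C(d,x_0)>0$ with $$\mathbf P[T(0,x_0)\ge n]\le C\exp\{-n^{\gamma}\}\qquad\text{for all integers } n\ge 0 .$$ -/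

import Mathlib

open MeasureTheory ProbabilityTheory

/-- The discrete time process `S` on the probability space `(Ω, μ)` is a simple random walk
on `ℤ^d` started at `x`: its increments are independent and each of them takes every one of
the `2 d` values `± e_i` with probability `1 / (2 d)`. -/
structure IsSRW {d : ℕ} {Ω : Type*} [MeasurableSpace Ω] (μ : Measure Ω)
    (x : Fin d → ℤ) (S : ℕ → Ω → (Fin d → ℤ)) : Prop where
  measurable : ∀ n, Measurable (S n)
  start : ∀ ω, S 0 ω = x
  indep : iIndepFun (fun (n : ℕ) (ω : Ω) => S (n + 1) ω - S n ω) μ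
  step_pos : ∀ (n : ℕ) (i : Fin d),
    μ {ω | S (n + 1) ω - S n ω = Pi.single i 1} = (2 * (d : ENNReal))⁻¹
  step_neg : ∀ (n : ℕ) (i : Fin d),
    μ {ω | S (n + 1) ω - S n ω = -Pi.single i 1} = (2 * (d : ENNReal))⁻¹

/-- The particle trajectories of the frog model with one particle per site: a family of
independent simple random walks `(S x n)_n`, one started at each site `x` of `ℤ^d`. -/
structure IsFrogFamily {d : ℕ} {Ω : Type*} [MeasurableSpace Ω] (μ : Measure Ω)
    (S : (Fin d → ℤ) → ℕ → Ω → (Fin d → ℤ)) : Prop where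
  srw : ∀ x, IsSRW μ x (S x)
  indep : iIndepFun (fun (x : Fin d → ℤ) (ω : Ω) (n : ℕ) => S x n ω) μ

/-- `t(x, z) = min {n : S^x_n = z}`, which is `⊤` if the walk from `x` never visits `z`. -/
noncomputable def hitTime {d : ℕ} {Ω : Type*} (S : (Fin d → ℤ) → ℕ → Ω → (Fin d → ℤ))
    (x z : Fin d → ℤ) (ω : Ω) : ℕ∞ :=
  ⨅ (n : ℕ) (_ : S x n ω = z), (n : ℕ∞)

/-- The passage time `T(x, z)` of the frog model: the infimum of
`∑_{i=1}^k t(x_{i-1}, x_i)` over all finite sequences `x = x_0, …, x_k = z` of sites. -/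
noncomputable def passageTime {d : ℕ} {Ω : Type*} (S : (Fin d → ℤ) → ℕ → Ω → (Fin d → ℤ))
    (x z : Fin d → ℤ) (ω : Ω) : ℕ∞ :=
  ⨅ (k : ℕ) (p : Fin (k + 1) → (Fin d → ℤ)) (_ : p 0 = x) (_ : p (Fin.last k) = z),
    ∑ i : Fin k, hitTime S (p i.castSucc) (p i.succ) ω

/-!
The walk of the origin leaves the slab `{|x i₀| < ρ}` within `ρ ^ 3` steps except with a probability
exponentially small in `ρ`, and has then woken at least `ρ` walks. From there the number of woken
sites is multiplied from layer to layer. The mechanism is a hitting estimate: from distance at most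
`R`, simple random walk enters a ball of radius `l` within `O (R ^ (d + 1))` steps with probability
at least `c (l / R) ^ (d - 1)` (`le_hitProb_latticeBall`). The exponent `d - 1` is not optimal, but it
is smaller than `d`, and this is all that matters: if each of `s ^ d` disjoint balls of radius `R / s`
contains a woken site, then there are `s ^ d` walks at hand, and all the balls of radius `R / s'` are
entered by one of them as long as `s' ^ (d - 1)` is much smaller than `s ^ d`. So one may take
`s' = s L` once `s` is at least `L ^ (d + 1)`, where `L` is the scale parameter and `R` is comparable
to a fixed power of `L`. After a number of layers depending only on `d` the balls are single sites,
and `R ^ d` walks suffice to hit the given site `x₀`. Each stage fails with probability at most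
`C exp (-L)` and the total time is a fixed power of `L`, whence the stretched exponential tail.

The hitting estimate holds because `|x| ^ (1 - d)` is strictly subharmonic for the lattice Laplacian
far from the origin, as `d - 1 > d - 2` (`le_nbrAvg_rpow`). The amount of subharmonicity pays for the
restriction to finitely many steps in the comparison principle `le_hitProb`.

Independence of the stages is obtained by putting the balls of different layers in disjoint regions:
which sites of a layer are woken depends only on walks started in earlier layers
(`measurableSet_mem_visitedLayer`), so that failure probabilities computed for a deterministic set of
woken sites add up (`IsFrogFamily.real_not_visitedLayer_le`).
-/

/-! ### Hitting probabilities and the Markov property -/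

/-- The average of `f` over the `2 d` lattice neighbours of `y`. -/
noncomputable def nbrAvg {d : ℕ} (f : (Fin d → ℤ) → ℝ) (y : Fin d → ℤ) : ℝ :=
  (∑ i : Fin d, (f (y + Pi.single i 1) + f (y - Pi.single i 1))) / (2 * d)

open Classical in
/-- The probability that simple random walk started at `y` enters `B` within `m` steps,
defined through its one-step recursion. -/
noncomputable def hitProb {d : ℕ} (B : Set (Fin d → ℤ)) : ℕ → (Fin d → ℤ) → ℝ
  | 0, y => if y ∈ B then 1 else 0
  | m + 1, y => if y ∈ B then 1 else nbrAvg (hitProb B m) y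

section hitProb

variable {d : ℕ} {B : Set (Fin d → ℤ)}

lemma hitProb_of_mem {y : Fin d → ℤ} (hy : y ∈ B) (m : ℕ) : hitProb B m y = 1 := by
  cases m <;> simp [hitProb, hy]

lemma hitProb_succ {y : Fin d → ℤ} (hy : y ∉ B) (m : ℕ) :
    hitProb B (m + 1) y = nbrAvg (hitProb B m) y := by
  simp [hitProb, hy]

lemma nbrAvg_mono {f g : (Fin d → ℤ) → ℝ} {y : Fin d → ℤ}
    (h : ∀ i, f (y + Pi.single i 1) ≤ g (y + Pi.single i 1) ∧
      f (y - Pi.single i 1) ≤ g (y - Pi.single i 1)) : nbrAvg f y ≤ nbrAvg g y := by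
  unfold nbrAvg
  gcongr with i
  · exact (h i).1
  · exact (h i).2

lemma nbrAvg_nonneg {f : (Fin d → ℤ) → ℝ} {y : Fin d → ℤ}
    (h : ∀ x, 0 ≤ f x) : 0 ≤ nbrAvg f y := by
  unfold nbrAvg
  exact div_nonneg (Finset.sum_nonneg fun i _ => add_nonneg (h _) (h _)) (by positivity)

lemma hitProb_nonneg (m : ℕ) (y : Fin d → ℤ) : 0 ≤ hitProb B m y := by
  induction m generalizing y with
  | zero => by_cases hy : y ∈ B <;> simp [hitProb, hy]
  | succ m ih =>
    by_cases hy : y ∈ B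
    · simp [hitProb_of_mem hy]
    · rw [hitProb_succ hy]; exact nbrAvg_nonneg ih

/-- Comparison principle: a function of remaining time and position which is at most `1` on `B`,
nonpositive off `B` at time zero, and dominated off `B` by its one-step average or by `0`,
is a lower bound for the hitting probability. -/
lemma le_hitProb {w : ℕ → (Fin d → ℤ) → ℝ} (h1 : ∀ m, ∀ y ∈ B, w m y ≤ 1)
    (h0 : ∀ y ∉ B, w 0 y ≤ 0)
    (hs : ∀ m, ∀ y ∉ B, w (m + 1) y ≤ nbrAvg (w m) y ∨ w (m + 1) y ≤ 0) (m : ℕ)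
    (y : Fin d → ℤ) : w m y ≤ hitProb B m y := by
  induction m generalizing y with
  | zero =>
    by_cases hy : y ∈ B
    · rw [hitProb_of_mem hy]; exact h1 0 y hy
    · exact (h0 y hy).trans (hitProb_nonneg _ _)
  | succ m ih =>
    by_cases hy : y ∈ B
    · rw [hitProb_of_mem hy]; exact h1 _ y hy
    · rcases hs m y hy with h | h
      · rw [hitProb_succ hy]
        exact h.trans (nbrAvg_mono fun i => ⟨ih _, ih _⟩)
      · exact h.trans (hitProb_nonneg _ _)

end hitProb

section Markov

variable {d : ℕ} {Ω : Type*} [MeasurableSpace Ω] {μ : Measure Ω}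
  {x : Fin d → ℤ} {S : ℕ → Ω → (Fin d → ℤ)}

/-- The σ-algebra generated by the first `k` increments of the process `S`. -/
abbrev pastIncr {d : ℕ} {Ω : Type*} (S : ℕ → Ω → (Fin d → ℤ)) (k : ℕ) : MeasurableSpace Ω :=
  ⨆ j ∈ Set.Iio k, MeasurableSpace.comap (fun ω => S (j + 1) ω - S j ω) inferInstance

lemma pastIncr_mono {d : ℕ} {Ω : Type*} (S : ℕ → Ω → (Fin d → ℤ)) {k l : ℕ} (h : k ≤ l) :
    pastIncr S k ≤ pastIncr S l :=
  biSup_mono fun _ hj => lt_of_lt_of_le hj h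

lemma IsSRW.measurable_incr (h : IsSRW μ x S) (j : ℕ) :
    Measurable (fun ω => S (j + 1) ω - S j ω) := (h.measurable _).sub (h.measurable _)

lemma IsSRW.pastIncr_le (h : IsSRW μ x S) (k : ℕ) : pastIncr S k ≤ ‹MeasurableSpace Ω› :=
  iSup₂_le fun j _ => (h.measurable_incr j).comap_le

lemma measurableSet_incr_eq {d : ℕ} {Ω : Type*} (S : ℕ → Ω → (Fin d → ℤ)) (k : ℕ) (e : Fin d → ℤ) :
    MeasurableSet[pastIncr S (k + 1)] {ω | S (k + 1) ω - S k ω = e} := by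
  have : MeasurableSpace.comap (fun ω => S (k + 1) ω - S k ω) inferInstance
      ≤ pastIncr S (k + 1) :=
    le_iSup₂_of_le k (Set.mem_Iio.2 (Nat.lt_succ_self k)) le_rfl
  exact this _ ⟨{e}, measurableSet_singleton e, rfl⟩

lemma IsSRW.real_inter_incr (h : IsSRW μ x S) {k : ℕ} {E : Set Ω}
    (hE : MeasurableSet[pastIncr S k] E) (e : Fin d → ℤ) :
    μ.real (E ∩ {ω | S (k + 1) ω - S k ω = e}) =
      μ.real E * μ.real {ω | S (k + 1) ω - S k ω = e} := by
  have hi := indep_iSup_of_disjoint (S := Set.Iio k) (T := {k})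
    (fun j => (h.measurable_incr j).comap_le) h.indep (by simp)
  have := (Indep_iff _ _ μ).1 hi E {ω | S (k + 1) ω - S k ω = e} hE (by
    rw [iSup_singleton]
    exact ⟨{e}, measurableSet_singleton e, rfl⟩)
  simp only [measureReal_def, this, ENNReal.toReal_mul]

/-- The `2 d` unit steps `± e_i` of the lattice, the sign being encoded by a Boolean. -/
def unitStep {d : ℕ} (p : Fin d × Bool) : Fin d → ℤ :=
  if p.2 then Pi.single p.1 1 else -Pi.single p.1 1

lemma unitStep_injective : Function.Injective (unitStep (d := d)) := by
  rintro ⟨i, a⟩ ⟨j, b⟩ h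
  have h1 := congrFun h i
  have h2 := congrFun h j
  by_cases hij : i = j
  · subst hij
    cases a <;> cases b <;> simp [unitStep] at h1 ⊢
  · cases a <;> cases b <;> simp [unitStep, hij] at h1

lemma sum_unitStep_div (f : (Fin d → ℤ) → ℝ) (y : Fin d → ℤ) :
    ∑ p, f (y + unitStep p) * (2 * (d : ℝ))⁻¹ = nbrAvg f y := by
  rw [← Finset.sum_mul, Fintype.sum_prod_type, nbrAvg, div_eq_mul_inv]
  simp [unitStep, sub_eq_add_neg]

lemma IsSRW.real_step (h : IsSRW μ x S) (k : ℕ) (p : Fin d × Bool) :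
    μ.real {ω | S (k + 1) ω - S k ω = unitStep p} = (2 * (d : ℝ))⁻¹ := by
  rcases p with ⟨i, _ | _⟩
  · simp [measureReal_def, unitStep, h.step_neg]
  · simp [measureReal_def, unitStep, h.step_pos]

/-- The Markov property for the entrance time of `B`: on any event of the past on which the walk
sits at `y`, the conditional probability of entering `B` within `m` further steps is at least
`hitProb B m y`. -/
lemma IsSRW.mul_hitProb_le [IsProbabilityMeasure μ] (h : IsSRW μ x S) (B : Set (Fin d → ℤ))
    (m : ℕ) : ∀ (k : ℕ) (E : Set Ω) (y : Fin d → ℤ), MeasurableSet[pastIncr S k] E →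
      (∀ ω ∈ E, S k ω = y) →
      μ.real E * hitProb B m y ≤ μ.real (E ∩ {ω | ∃ n ≤ m, S (k + n) ω ∈ B}) := by
  induction m with
  | zero =>
    intro k E y _ hy
    by_cases hB : y ∈ B
    · rw [hitProb_of_mem hB, mul_one]
      exact measureReal_mono fun ω hω => ⟨hω, 0, le_rfl, by simpa [hy ω hω] using hB⟩
    · simp [hitProb, hB, measureReal_nonneg]
  | succ m ih =>
    intro k E y hE hy
    by_cases hB : y ∈ B
    · rw [hitProb_of_mem hB, mul_one]
      exact measureReal_mono fun ω hω => ⟨hω, 0, Nat.zero_le _, by simpa [hy ω hω] using hB⟩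
    set E' : Fin d × Bool → Set Ω := fun p => E ∩ {ω | S (k + 1) ω - S k ω = unitStep p} with hE'
    set H : Set Ω := {ω | ∃ n ≤ m, S (k + 1 + n) ω ∈ B} with hH
    have hm : ∀ p, MeasurableSet[pastIncr S (k + 1)] (E' p) := fun p =>
      MeasurableSet.inter (pastIncr_mono S (Nat.le_succ k) _ hE)
        (measurableSet_incr_eq S k _)
    have hHm : MeasurableSet H := by
      have : H = ⋃ n ∈ Set.Iic m, S (k + 1 + n) ⁻¹' B := by ext; simp [hH]
      rw [this]
      exact MeasurableSet.biUnion (Set.to_countable _) fun n _ =>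
        h.measurable _ (Set.to_countable B).measurableSet
    have hd : Pairwise (Function.onFun Disjoint fun p => E' p ∩ H) := by
      intro p p' hpp
      refine Set.disjoint_left.2 fun ω hω hω' => hpp (unitStep_injective ?_)
      exact hω.1.2.symm.trans hω'.1.2
    calc μ.real E * hitProb B (m + 1) y
        = ∑ p, μ.real (E' p) * hitProb B m (y + unitStep p) := by
          rw [hitProb_succ hB, ← sum_unitStep_div, Finset.mul_sum]
          refine Finset.sum_congr rfl fun p _ => ?_
          rw [hE', h.real_inter_incr hE, h.real_step]; ring
      _ ≤ ∑ p, μ.real (E' p ∩ H) := by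
          refine Finset.sum_le_sum fun p _ => ih (k + 1) (E' p) _ (hm p) fun ω hω => ?_
          have h1 : S (k + 1) ω - S k ω = unitStep p := hω.2
          rw [← h1, ← hy ω hω.1]; abel
      _ = μ.real (⋃ p, E' p ∩ H) := by
          rw [measureReal_iUnion_fintype hd fun p => ((h.pastIncr_le _ _ (hm p)).inter hHm)]
      _ ≤ _ := by
          refine measureReal_mono (Set.iUnion_subset fun p ω hω => ⟨hω.1.1, ?_⟩)
          obtain ⟨n, hn, hb⟩ := hω.2
          exact ⟨n + 1, by omega, by convert hb using 2; omega⟩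

lemma IsSRW.hitProb_le [IsProbabilityMeasure μ] (h : IsSRW μ x S) (B : Set (Fin d → ℤ)) (m : ℕ) :
    hitProb B m x ≤ μ.real {ω | ∃ n ≤ m, S n ω ∈ B} := by
  have := h.mul_hitProb_le B m 0 Set.univ x MeasurableSet.univ (fun ω _ => h.start ω)
  simpa using this

lemma IsSRW.measurableSet_hit (h : IsSRW μ x S) (B : Set (Fin d → ℤ)) (m : ℕ) :
    MeasurableSet {ω | ∃ n ≤ m, S n ω ∈ B} := by
  have : {ω | ∃ n ≤ m, S n ω ∈ B} = ⋃ n ∈ Set.Iic m, S n ⁻¹' B := by ext; simp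
  rw [this]
  exact MeasurableSet.biUnion (Set.to_countable _) fun n _ =>
    h.measurable _ (Set.to_countable B).measurableSet

/-- Almost surely every step of a simple random walk is one of the `2 d` unit steps. -/
lemma IsSRW.ae_step [IsProbabilityMeasure μ] (h : IsSRW μ x S) (hd : d ≠ 0) :
    ∀ᵐ ω ∂μ, ∀ n, ∃ p, S (n + 1) ω = S n ω + unitStep p := by
  rw [ae_all_iff]
  intro n
  have hm : ∀ p : Fin d × Bool, MeasurableSet {ω | S (n + 1) ω - S n ω = unitStep p} := fun p =>
    h.pastIncr_le _ _ (measurableSet_incr_eq S n _)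
  have h1 : μ.real (⋃ p, {ω | S (n + 1) ω - S n ω = unitStep p}) = 1 := by
    rw [measureReal_iUnion_fintype _ hm]
    · simp only [h.real_step]
      have : (d : ℝ) ≠ 0 := by exact_mod_cast hd
      simp; field_simp
    · intro p p' hpp
      exact Set.disjoint_left.2 fun ω hω hω' => hpp (unitStep_injective (hω.symm.trans hω'))
  have h2 : μ (⋃ p, {ω | S (n + 1) ω - S n ω = unitStep p}) = 1 := by
    rw [measureReal_def] at h1
    exact (ENNReal.toReal_eq_one_iff _).1 h1
  have h3 := (mem_ae_iff_prob_eq_one (MeasurableSet.iUnion hm)).2 h2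
  filter_upwards [h3] with ω hω
  obtain ⟨p, hp⟩ := Set.mem_iUnion.1 hω
  exact ⟨p, by rw [← (show S (n + 1) ω - S n ω = unitStep p from hp)]; abel⟩

end Markov

/-! ### Exit from slabs and the lattice Laplacian of powers -/

section nbrAvg

variable {d : ℕ}

lemma nbrAvg_affine (hd : d ≠ 0) (f : (Fin d → ℤ) → ℝ) (a b : ℝ) (y : Fin d → ℤ) :
    nbrAvg (fun x => a * f x + b) y = a * nbrAvg f y + b := by
  have h : (d : ℝ) ≠ 0 := by exact_mod_cast hd
  have : ∑ i : Fin d, (a * f (y + Pi.single i 1) + b + (a * f (y - Pi.single i 1) + b))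
      = a * (∑ i : Fin d, (f (y + Pi.single i 1) + f (y - Pi.single i 1))) + 2 * d * b := by
    rw [Finset.mul_sum, show 2 * (d : ℝ) * b = ∑ _i : Fin d, 2 * b by simp; ring,
      ← Finset.sum_add_distrib]
    exact Finset.sum_congr rfl fun i _ => by ring
  rw [nbrAvg, this, nbrAvg]
  field_simp

lemma nbrAvg_coord (hd : d ≠ 0) (g : ℤ → ℝ) (i : Fin d) (y : Fin d → ℤ) :
    nbrAvg (fun x => g (x i)) y
      = g (y i) + (g (y i + 1) + g (y i - 1) - 2 * g (y i)) / (2 * d) := by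
  have h : (d : ℝ) ≠ 0 := by exact_mod_cast hd
  have : ∑ j : Fin d, (g ((y + Pi.single j 1 : Fin d → ℤ) i) +
        g ((y - Pi.single j 1 : Fin d → ℤ) i))
      = ∑ j : Fin d, (2 * g (y i) +
        if j = i then (g (y i + 1) + g (y i - 1) - 2 * g (y i)) else 0) := by
    refine Finset.sum_congr rfl fun j _ => ?_
    by_cases hj : j = i
    · subst hj; simp
    · simp [hj, Ne.symm hj]; ring
  rw [nbrAvg, this, Finset.sum_add_distrib]
  simp
  field_simp

end nbrAvg

/-- Exit from a slab: the walk started at the origin leaves `{|y i| < ρ}` within `m` steps except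
with a probability exponentially small in `m / ρ²`. The supersolution is
`(1 - 1 / (2 d ρ²)) ^ m * (2 ρ² - (y i)²) / ρ²`. -/
lemma one_sub_le_hitProb_slab {d : ℕ} (hd : d ≠ 0) (i : Fin d) {ρ : ℕ} (hρ : 1 ≤ ρ) (m : ℕ) :
    1 - 2 * Real.exp (-(m / (2 * d * (ρ : ℝ) ^ 2))) ≤
      hitProb {y : Fin d → ℤ | (ρ : ℤ) ≤ |y i|} m 0 := by
  have hd1 : (1 : ℝ) ≤ d := by exact_mod_cast Nat.one_le_iff_ne_zero.2 hd
  have hρ1 : (1 : ℝ) ≤ ρ := by exact_mod_cast hρ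
  set ε : ℝ := 1 / (2 * d * (ρ : ℝ) ^ 2) with hε
  have hε0 : 0 < ε := by positivity
  have hε1 : ε ≤ 1 := by
    rw [hε, div_le_one (by positivity)]
    nlinarith [mul_le_mul hd1 (one_le_pow₀ hρ1 : (1 : ℝ) ≤ ρ ^ 2) (by norm_num) (by linarith)]
  set g : ℤ → ℝ := fun t => max (2 * (ρ : ℝ) ^ 2 - (t : ℝ) ^ 2) 0 / (ρ : ℝ) ^ 2 with hg
  have hg0 : ∀ t, 0 ≤ g t := fun t => div_nonneg (le_max_right _ _) (by positivity)
  have hgt : ∀ t : ℤ, |t| ≤ ρ → g t = (2 * (ρ : ℝ) ^ 2 - (t : ℝ) ^ 2) / (ρ : ℝ) ^ 2 := by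
    intro t ht
    have h1 : |(t : ℝ)| ≤ ρ := by exact_mod_cast ht
    have h2 : (t : ℝ) ^ 2 ≤ (ρ : ℝ) ^ 2 := sq_le_sq' (by linarith [neg_abs_le (t : ℝ)])
      (by linarith [le_abs_self (t : ℝ)])
    simp only [hg]
    rw [max_eq_left (by nlinarith)]
  have key := le_hitProb (B := {y : Fin d → ℤ | (ρ : ℤ) ≤ |y i|})
    (w := fun m y => 1 - (1 - ε) ^ m * g (y i)) ?_ ?_ ?_ m 0
  · refine le_trans ?_ key
    have h2 : g ((0 : Fin d → ℤ) i) = 2 := by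
      rw [hgt _ (by simp)]; simp; field_simp
    simp only [h2]
    have h3 : (1 - ε) ^ m ≤ Real.exp (-(m / (2 * d * (ρ : ℝ) ^ 2))) := by
      calc (1 - ε) ^ m ≤ (Real.exp (-ε)) ^ m :=
            pow_le_pow_left₀ (by linarith) (Real.one_sub_le_exp_neg ε) m
        _ = _ := by rw [← Real.exp_nat_mul]; congr 1; rw [hε]; ring
    linarith
  · intro m y _
    have := mul_nonneg (pow_nonneg (sub_nonneg.2 hε1) m) (hg0 (y i))
    linarith
  · intro y hy
    have hy' : |y i| < ρ := by simpa using hy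
    have h1 : |(y i : ℝ)| ≤ ρ := by exact_mod_cast hy'.le
    have h2 : (y i : ℝ) ^ 2 ≤ (ρ : ℝ) ^ 2 := sq_le_sq' (by linarith [neg_abs_le (y i : ℝ)])
      (by linarith [le_abs_self (y i : ℝ)])
    have : 1 ≤ g (y i) := by
      rw [hgt _ hy'.le, le_div_iff₀ (by positivity)]; linarith
    simpa using this
  · intro m y hy
    left
    have hy' : |y i| < ρ := by simpa using hy
    have e1 : |y i + 1| ≤ ρ := by rw [abs_lt] at hy'; rw [abs_le]; omega
    have e2 : |y i - 1| ≤ ρ := by rw [abs_lt] at hy'; rw [abs_le]; omega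
    have hav : nbrAvg (fun x : Fin d → ℤ => 1 - (1 - ε) ^ m * g (x i)) y
        = 1 - (1 - ε) ^ m * nbrAvg (fun x => g (x i)) y := by
      have := nbrAvg_affine hd (fun x : Fin d → ℤ => g (x i)) (-(1 - ε) ^ m) 1 y
      rw [show (fun x : Fin d → ℤ => 1 - (1 - ε) ^ m * g (x i))
        = fun x => -(1 - ε) ^ m * g (x i) + 1 by ext; ring, this]; ring
    have h4 : nbrAvg (fun x : Fin d → ℤ => g (x i)) y ≤ (1 - ε) * g (y i) := by
      rw [nbrAvg_coord hd, hgt _ e1, hgt _ e2, hgt _ hy'.le]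
      have e3 : (2 * (ρ : ℝ) ^ 2 - ((y i + 1 : ℤ) : ℝ) ^ 2) / (ρ : ℝ) ^ 2
          + (2 * (ρ : ℝ) ^ 2 - ((y i - 1 : ℤ) : ℝ) ^ 2) / (ρ : ℝ) ^ 2
          - 2 * ((2 * (ρ : ℝ) ^ 2 - (y i : ℝ) ^ 2) / (ρ : ℝ) ^ 2) = - 2 / (ρ : ℝ) ^ 2 := by
        push_cast; field_simp; ring
      have e4 : -2 / (ρ : ℝ) ^ 2 / (2 * d) = - 2 * ε := by rw [hε]; field_simp
      have e5 : (2 * (ρ : ℝ) ^ 2 - (y i : ℝ) ^ 2) / (ρ : ℝ) ^ 2 ≤ 2 := by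
        rw [div_le_iff₀ (by positivity)]; nlinarith [sq_nonneg (y i : ℝ)]
      rw [e3, e4]; nlinarith
    rw [hav, pow_succ, mul_assoc]
    have := mul_le_mul_of_nonneg_left h4 (pow_nonneg (sub_nonneg.2 hε1) m)
    linarith

/-- Second-order lower bound for the even part of the convex function `(1 + u) ^ (-b)`. -/
lemma two_add_le_rpow_neg_add {b u : ℝ} (hb : 0 ≤ b) (hu : |u| < 1) :
    2 + b * (b + 1) * u ^ 2 ≤ (1 + u) ^ (-b) + (1 - u) ^ (-b) := by
  wlog h0 : 0 ≤ u generalizing u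
  · have := this (u := -u) (by simpa using hu) (by linarith)
    simp only [neg_sq, sub_neg_eq_add, ← sub_eq_add_neg] at this
    linarith
  have hu1 : u < 1 := (abs_lt.1 hu).2
  have p1 : 0 < 1 + u := by linarith
  have p2 : 0 < 1 - u := by linarith
  rw [Real.rpow_def_of_pos p1, Real.rpow_def_of_pos p2]
  set a := Real.log (1 + u) with ha
  set c := Real.log (1 - u) with hc
  have hsum : a + c ≤ -u ^ 2 := by
    rw [ha, hc, ← Real.log_mul p1.ne' p2.ne']
    have := Real.log_le_sub_one_of_pos (mul_pos p1 p2)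
    nlinarith
  have hdiff : 2 * u ≤ a - c := by
    rw [ha, hc, ← Real.log_div p1.ne' p2.ne']
    have := Real.le_log_one_add_of_nonneg (x := 2 * u / (1 - u)) (by positivity)
    rw [show 1 + 2 * u / (1 - u) = (1 + u) / (1 - u) by field_simp; ring] at this
    refine le_trans (le_of_eq ?_) this
    field_simp
    ring
  have hcosh : ∀ x : ℝ, 0 ≤ x → 1 + x ^ 2 / 2 ≤ Real.cosh x := by
    intro x hx
    have h1 : x / 2 ≤ Real.sinh (x / 2) := Real.self_le_sinh_iff.2 (by linarith)
    have h2 := Real.cosh_two_mul (x / 2)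
    rw [mul_div_cancel₀ _ two_ne_zero, Real.cosh_sq] at h2
    nlinarith
  have e : Real.exp (a * -b) + Real.exp (c * -b)
      = 2 * Real.exp (-(b * (a + c) / 2)) * Real.cosh (b * (a - c) / 2) := by
    rw [Real.cosh_eq]
    have : ∀ x y z : ℝ, 2 * Real.exp x * ((Real.exp y + Real.exp z) / 2)
        = Real.exp (x + z) + Real.exp (x + y) := by
      intro x y z; rw [Real.exp_add, Real.exp_add]; ring
    rw [this]; congr 2 <;> ring
  rw [e]
  have h1 : 1 + b * u ^ 2 / 2 ≤ Real.exp (-(b * (a + c) / 2)) := by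
    refine le_trans ?_ (Real.add_one_le_exp _)
    nlinarith
  have h2 : 1 + (b * u) ^ 2 / 2 ≤ Real.cosh (b * (a - c) / 2) := by
    refine le_trans ?_ (hcosh _ (by nlinarith))
    have : b * u ≤ b * (a - c) / 2 := by nlinarith
    have := pow_le_pow_left₀ (by positivity) this 2
    linarith
  have h3 := mul_le_mul h1 h2 (by positivity) (Real.exp_pos _).le
  nlinarith [mul_nonneg (mul_nonneg hb (sq_nonneg u)) (sq_nonneg (b * u))]

/-- The squared Euclidean length of a lattice point. -/
def latticeNormSq {d : ℕ} (x : Fin d → ℤ) : ℤ := ∑ i, x i ^ 2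

section latticeNormSq

variable {d : ℕ}

lemma sq_le_latticeNormSq (x : Fin d → ℤ) (i : Fin d) : x i ^ 2 ≤ latticeNormSq x :=
  Finset.single_le_sum (f := fun i => x i ^ 2) (fun _ _ => sq_nonneg _) (Finset.mem_univ i)

lemma latticeNormSq_add_single (x : Fin d → ℤ) (i : Fin d) (a : ℤ) :
    latticeNormSq (x + Pi.single i a) = latticeNormSq x + 2 * a * x i + a ^ 2 := by
  have : ∀ j, (x + Pi.single i a : Fin d → ℤ) j ^ 2 = 
      x j ^ 2 + if j = i then 2 * a * x i + a ^ 2 else 0 := by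
    intro j
    by_cases hj : j = i
    · subst hj; simp; ring
    · simp [hj]
  simp only [latticeNormSq, this, Finset.sum_add_distrib]
  simp; ring

lemma latticeNormSq_sub_single (x : Fin d → ℤ) (i : Fin d) :
    latticeNormSq (x - Pi.single i 1) = latticeNormSq x - 2 * x i + 1 := by
  rw [sub_eq_add_neg, ← Pi.single_neg, latticeNormSq_add_single]; ring

end latticeNormSq

/-- For `b = (d - 1) / 2` the function `|x| ^ (-2 b)` is strictly subharmonic for the lattice
Laplacian away from the origin, since `2 b > d - 2`. -/
lemma le_nbrAvg_rpow {d : ℕ} (hd : 2 ≤ d) {b : ℝ} (hb : 2 * b = d - 1) {y : Fin d → ℤ}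
    (hy : 16 * (d : ℤ) ^ 2 ≤ latticeNormSq y) :
    (latticeNormSq y : ℝ) ^ (-b) +
        (2 : ℝ) ^ (-b) * b / (2 * d) * (latticeNormSq y : ℝ) ^ (-b - 1) ≤
      nbrAvg (fun x => (latticeNormSq x : ℝ) ^ (-b)) y := by
  have hd2 : (2 : ℝ) ≤ d := by exact_mod_cast hd
  have hb0 : 0 < b := by linarith
  set t : ℝ := (latticeNormSq y : ℝ) with ht
  have hty : 16 * (d : ℝ) ^ 2 ≤ t := by rw [ht]; exact_mod_cast hy
  have ht64 : 64 ≤ t := by nlinarith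
  have ht0 : 0 < t := by linarith
  have hs0 : 0 < t + 1 := by linarith
  have hsum : ∑ i, (y i : ℝ) ^ 2 = t := by rw [ht, latticeNormSq]; push_cast; rfl
  have h1 : (t + 1) ^ (-b) * (1 + b * (1 + 1 / d) * (t / (t + 1) ^ 2)) ≤
      nbrAvg (fun x => (latticeNormSq x : ℝ) ^ (-b)) y := by
    rw [nbrAvg, le_div_iff₀ (by positivity)]
    have hi : ∀ i, (t + 1) ^ (-b) * (2 + b * (b + 1) * (2 * y i / (t + 1)) ^ 2) ≤
        ((latticeNormSq (y + Pi.single i 1) : ℤ) : ℝ) ^ (-b) +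
        ((latticeNormSq (y - Pi.single i 1) : ℤ) : ℝ) ^ (-b) := by
      intro i
      have hyi : (y i : ℝ) ^ 2 ≤ t := by rw [ht]; exact_mod_cast sq_le_latticeNormSq y i
      have hu : |2 * (y i : ℝ) / (t + 1)| < 1 := by
        rw [abs_div, abs_of_pos hs0, div_lt_one hs0]
        apply abs_lt_of_sq_lt_sq _ hs0.le
        nlinarith
      have hu' := abs_lt.1 hu
      refine (mul_le_mul_of_nonneg_left (two_add_le_rpow_neg_add hb0.le hu)
        (by positivity)).trans (le_of_eq ?_)
      rw [mul_add, ← Real.mul_rpow hs0.le (by linarith), ← Real.mul_rpow hs0.le (by linarith),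
        latticeNormSq_add_single, latticeNormSq_sub_single]
      congr 2
      · push_cast; rw [← ht]; field_simp; ring
      · push_cast; rw [← ht]; field_simp; ring
    refine le_trans (le_of_eq ?_) (Finset.sum_le_sum fun i _ => hi i)
    have : ∀ i, (t + 1) ^ (-b) * (2 + b * (b + 1) * (2 * y i / (t + 1)) ^ 2) =
        (t + 1) ^ (-b) * 2 + (t + 1) ^ (-b) * (b * (b + 1)) * 4 / (t + 1) ^ 2 * (y i : ℝ) ^ 2 := by
      intro i; field_simp; ring
    simp only [this, Finset.sum_add_distrib, ← Finset.mul_sum, hsum]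
    have hbb : b + 1 = (d + 1) / 2 := by linarith
    rw [hbb]
    simp
    field_simp
    ring
  refine le_trans ?_ h1
  have hs : t ^ (-b) = (t + 1) ^ (-b) * (1 + 1 / t) ^ b := by
    have : (t + 1) = t * (1 + 1 / t) := by field_simp
    rw [this, Real.mul_rpow ht0.le (by positivity), mul_assoc, ← Real.rpow_add (by positivity)]
    simp
  -- second-order upper bound for the value at `y`, to be compared with the lower bound `h1`
  have hbt : b / t ≤ 1 := by rw [div_le_one ht0]; nlinarith
  have h2 : (1 + 1 / t) ^ b ≤ 1 + b / t + (b / t) ^ 2 := by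
    have e1 : (1 + 1 / t) ^ b ≤ Real.exp (b / t) := by
      rw [show b / t = (1 / t) * b by ring, Real.exp_mul]
      exact Real.rpow_le_rpow (by positivity) (by linarith [Real.add_one_le_exp (1 / t)]) hb0.le
    have e2 := Real.abs_exp_sub_one_sub_id_le (x := b / t)
      (by rw [abs_of_pos (by positivity)]; exact hbt)
    have := (abs_le.1 e2).2
    linarith
  have h3 : (2 : ℝ) ^ (-b) * b / (2 * d) * t ^ (-b - 1) ≤ (t + 1) ^ (-b) * (b / (2 * d * t)) := by
    rw [Real.rpow_sub ht0, Real.rpow_one]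
    have : (2 : ℝ) ^ (-b) * t ^ (-b) ≤ (t + 1) ^ (-b) := by
      rw [← Real.mul_rpow (by norm_num) ht0.le]
      exact Real.rpow_le_rpow_of_nonpos hs0 (by linarith) (by linarith)
    calc (2 : ℝ) ^ (-b) * b / (2 * d) * (t ^ (-b) / t)
        = ((2 : ℝ) ^ (-b) * t ^ (-b)) * (b / (2 * d * t)) := by field_simp
      _ ≤ _ := mul_le_mul_of_nonneg_right this (by positivity)
  have h4 : 1 + b / t + (b / t) ^ 2 + b / (2 * d * t)
      ≤ 1 + b * (1 + 1 / d) * (t / (t + 1) ^ 2) := by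
    have e1 : 1 / t - 2 / t ^ 2 ≤ t / (t + 1) ^ 2 := by
      rw [div_sub_div _ _ (by positivity) (by positivity),
        div_le_div_iff₀ (by positivity) (by positivity)]
      nlinarith [mul_pos ht0 ht0, pow_pos ht0 3, pow_pos ht0 4]
    have e2 : b * (1 + 1 / d) * (1 / t - 2 / t ^ 2) ≤ b * (1 + 1 / d) * (t / (t + 1) ^ 2) :=
      mul_le_mul_of_nonneg_left e1 (by positivity)
    have e3 : b * (1 + 1 / d) * (1 / t - 2 / t ^ 2) - (b / t + (b / t) ^ 2 + b / (2 * d * t))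
        = b / (2 * d * t ^ 2) * (t - (4 * d + 4 + 2 * d * b)) := by
      field_simp; ring
    have e4 : 0 ≤ b / (2 * d * t ^ 2) * (t - (4 * d + 4 + 2 * d * b)) := by
      refine mul_nonneg (by positivity) ?_
      nlinarith
    linarith
  rw [hs]
  have h5 := mul_le_mul_of_nonneg_left h2 (Real.rpow_nonneg hs0.le (-b))
  have h6 := mul_le_mul_of_nonneg_left h4 (Real.rpow_nonneg hs0.le (-b))
  linarith

/-! ### Hitting probabilities of balls -/

/-- The set of lattice points at Euclidean distance less than `l` from `z`. -/
def latticeBall {d : ℕ} (z : Fin d → ℤ) (l : ℕ) : Set (Fin d → ℤ) :=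
  {x | latticeNormSq (x - z) < (l : ℤ) ^ 2}

section ballHitting

variable {d : ℕ}

lemma mem_latticeBall_self (z : Fin d → ℤ) {l : ℕ} (hl : 1 ≤ l) : z ∈ latticeBall z l := by
  have : (1 : ℤ) ≤ l := by exact_mod_cast hl
  have : (0 : ℤ) < (l : ℤ) ^ 2 := by positivity
  simpa [latticeBall, latticeNormSq] using this

/-- Far from the origin, passing to a neighbour at most halves the squared length. This keeps the
truncation of the comparison function in `le_hitProb_largeBall` away from the points where its
Laplacian is computed. -/
lemma half_le_latticeNormSq_nbr {x : Fin d → ℤ} (hx : 16 ≤ latticeNormSq x) (i : Fin d) :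
    (latticeNormSq x : ℝ) / 2 ≤ latticeNormSq (x + Pi.single i 1) ∧
      (latticeNormSq x : ℝ) / 2 ≤ latticeNormSq (x - Pi.single i 1) := by
  rw [latticeNormSq_add_single, latticeNormSq_sub_single]
  have h1 : (x i : ℝ) ^ 2 ≤ latticeNormSq x := by exact_mod_cast sq_le_latticeNormSq x i
  have h2 : (16 : ℝ) ≤ latticeNormSq x := by exact_mod_cast hx
  have h3 : |2 * (x i : ℝ)| ≤ (latticeNormSq x : ℝ) / 2 :=
    abs_le_of_sq_le_sq (by nlinarith) (by linarith)
  have h4 := abs_le.1 h3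
  push_cast
  constructor <;> linarith

/-- The hitting estimate for large balls, with the truncated power `|x - z| ^ (1 - d)` as
subharmonic comparison function. Its strict subharmonicity bounds the time needed. -/
lemma le_hitProb_largeBall (hd : 2 ≤ d) :
    ∃ c C : ℝ, 0 < c ∧ 0 < C ∧ ∀ (l R : ℕ) (z y : Fin d → ℤ), 4 * d ≤ l → l ≤ R →
      latticeNormSq (y - z) ≤ (R : ℤ) ^ 2 → ∀ N : ℕ, C * (R : ℝ) ^ (d + 1) ≤ N →
      c * ((l : ℝ) / R) ^ (d - 1) ≤ hitProb (latticeBall z l) N y := by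
  have hd0 : d ≠ 0 := by omega
  have hd2 : (2 : ℝ) ≤ d := by exact_mod_cast hd
  obtain ⟨b, hb⟩ : ∃ b : ℝ, 2 * b = d - 1 := ⟨(d - 1) / 2, by ring⟩
  have hb0 : 0 < b := by linarith
  set c0 : ℝ := (2 : ℝ) ^ (-b) * b / (2 * d) with hc0
  have hc0p : 0 < c0 := by positivity
  have h16 : (16 : ℝ) ^ (-b) < 1 := Real.rpow_lt_one_of_one_lt_of_neg (by norm_num) (by linarith)
  -- `(d - 1)`-th and `(d + 1)`-th powers as real powers of squares
  have hpow1 : ∀ a : ℝ, 0 ≤ a → a ^ (d - 1) = (a ^ 2) ^ b := by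
    intro a ha
    rw [← Real.rpow_natCast a 2, ← Real.rpow_mul ha, ← Real.rpow_natCast a (d - 1)]
    congr 1
    rw [Nat.cast_sub (by omega)]; push_cast; linarith
  have hpow2 : ∀ a : ℝ, 0 ≤ a → a ^ (d + 1) = (a ^ 2) ^ (b + 1) := by
    intro a ha
    rw [← Real.rpow_natCast a 2, ← Real.rpow_mul ha, ← Real.rpow_natCast a (d + 1)]
    congr 1
    push_cast; linarith
  refine ⟨(1 - (16 : ℝ) ^ (-b)) * 2 ^ (-b), 16 ^ (b + 1) / c0, ?_, by positivity, ?_⟩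
  · have : 0 < 1 - (16 : ℝ) ^ (-b) := by linarith
    positivity
  intro l R z y hl hlR hyR N hN
  have hl8 : (8 : ℝ) ≤ l := by
    have : (4 * d : ℝ) ≤ l := by exact_mod_cast hl
    linarith
  have hlR' : (l : ℝ) ≤ R := by exact_mod_cast hlR
  have hR0 : (0 : ℝ) < R := by linarith
  set K : ℝ := (l : ℝ) ^ 2 / 2 with hK
  have hK0 : 0 < K := by positivity
  have hK1 : 1 ≤ K := by rw [hK]; nlinarith
  set M : ℝ := K ^ (-b) with hM
  have hM0 : 0 < M := by positivity
  set far : ℝ := (16 * (R : ℝ) ^ 2) ^ (-b) with hfar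
  have hfar0 : 0 < far := by positivity
  -- the gain `η` per step, valid up to distance `4 R`, lowers the constant subtracted from `f` from
  -- `M` to `far` as the remaining time grows
  set η : ℝ := c0 * (16 * (R : ℝ) ^ 2) ^ (-b - 1) with hη
  have hη0 : 0 < η := by positivity
  set f : (Fin d → ℤ) → ℝ := fun x => (max (latticeNormSq (x - z) : ℝ) K) ^ (-b) with hf
  have hfM : ∀ x, f x ≤ M := fun x =>
    Real.rpow_le_rpow_of_nonpos hK0 (le_max_right _ _) (by linarith)
  have hball : ∀ x, x ∉ latticeBall z l → 2 * K ≤ latticeNormSq (x - z) := by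
    intro x hx
    have : (l : ℤ) ^ 2 ≤ latticeNormSq (x - z) := by simpa [latticeBall] using hx
    rw [hK]
    have h' : ((l : ℝ)) ^ 2 ≤ latticeNormSq (x - z) := by exact_mod_cast this
    linarith
  have hfeq : ∀ x, x ∉ latticeBall z l → f x = (latticeNormSq (x - z) : ℝ) ^ (-b) := by
    intro x hx
    simp only [hf]
    rw [max_eq_left (by linarith [hball x hx])]
  have hsub : ∀ x, x ∉ latticeBall z l → far < f x → f x + η ≤ nbrAvg f x := by
    intro x hx hfx
    have h2K := hball x hx
    have hbig : 16 * (d : ℤ) ^ 2 ≤ latticeNormSq (x - z) := by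
      have : (l : ℤ) ^ 2 ≤ latticeNormSq (x - z) := by simpa [latticeBall] using hx
      have h4 : (4 * d : ℤ) ≤ l := by exact_mod_cast hl
      nlinarith
    have hpos : (0 : ℝ) < latticeNormSq (x - z) := by linarith
    have hnb : nbrAvg f x = nbrAvg (fun x => (latticeNormSq x : ℝ) ^ (-b)) (x - z) := by
      unfold nbrAvg
      congr 1
      refine Finset.sum_congr rfl fun i _ => ?_
      have h16' : 16 ≤ latticeNormSq (x - z) := by
        have : (1 : ℤ) ≤ d := by exact_mod_cast Nat.one_le_iff_ne_zero.2 hd0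
        nlinarith
      have hh := half_le_latticeNormSq_nbr h16' i
      simp only [hf]
      rw [add_sub_right_comm, sub_right_comm, max_eq_left (by linarith [hh.1]),
        max_eq_left (by linarith [hh.2])]
    rw [hnb]
    refine le_trans ?_ (le_nbrAvg_rpow hd hb hbig)
    rw [hfeq x hx]
    have hlt : (latticeNormSq (x - z) : ℝ) < 16 * (R : ℝ) ^ 2 := by
      by_contra hcon
      push Not at hcon
      rw [hfeq x hx] at hfx
      exact absurd (Real.rpow_le_rpow_of_nonpos (by positivity) hcon (by linarith)) (not_le.2 hfx)
    have : η ≤ c0 * (latticeNormSq (x - z) : ℝ) ^ (-b - 1) :=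
      mul_le_mul_of_nonneg_left
        (Real.rpow_le_rpow_of_nonpos hpos hlt.le (by linarith)) hc0p.le
    linarith
  have key := le_hitProb (B := latticeBall z l)
    (w := fun m x => (f x - max far (M - η * m)) / M) ?_ ?_ ?_ N y
  · refine le_trans ?_ key
    have hMN : M - η * N ≤ far := by
      have hM1 : M ≤ 1 := Real.rpow_le_one_of_one_le_of_nonpos hK1 (by linarith)
      have : 1 ≤ η * N := by
        calc (1 : ℝ) = η * (16 ^ (b + 1) / c0 * (R : ℝ) ^ (d + 1)) := by
              rw [hη, hpow2 _ hR0.le, show -b - 1 = -(b + 1) by ring,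
                Real.rpow_neg (by positivity), Real.mul_rpow (by norm_num) (by positivity)]
              field_simp
          _ ≤ _ := mul_le_mul_of_nonneg_left hN hη0.le
      linarith
    rw [max_eq_left hMN, le_div_iff₀ hM0]
    have hfy : ((R : ℝ) ^ 2) ^ (-b) ≤ f y := by
      refine Real.rpow_le_rpow_of_nonpos (by positivity) (max_le ?_ ?_) (by linarith)
      · exact_mod_cast hyR
      · rw [hK]; nlinarith
    have e1 : far = 16 ^ (-b) * ((R : ℝ) ^ 2) ^ (-b) :=
      Real.mul_rpow (by norm_num) (by positivity)
    have e2 : (1 - (16 : ℝ) ^ (-b)) * 2 ^ (-b) * ((l : ℝ) / R) ^ (d - 1) * M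
        = (1 - (16 : ℝ) ^ (-b)) * ((R : ℝ) ^ 2) ^ (-b) := by
      rw [hM, hK, hpow1 _ (by positivity), div_pow, Real.div_rpow (by positivity) (by positivity),
        Real.div_rpow (by positivity) (by positivity),
        Real.rpow_neg (by positivity : (0 : ℝ) ≤ (R : ℝ) ^ 2),
        Real.rpow_neg (by positivity : (0 : ℝ) ≤ (l : ℝ) ^ 2)]
      field_simp
    rw [e2, e1]
    linarith
  · intro m x _
    rw [div_le_one hM0]
    have := hfM x
    have : 0 ≤ max far (M - η * m) := hfar0.le.trans (le_max_left _ _)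
    linarith
  · intro x _
    refine div_nonpos_of_nonpos_of_nonneg ?_ hM0.le
    have h1 : M - η * ((0 : ℕ) : ℝ) ≤ max far (M - η * ((0 : ℕ) : ℝ)) := le_max_right _ _
    have := hfM x
    simp only [Nat.cast_zero, mul_zero, sub_zero] at h1 ⊢
    linarith
  · intro m x hx
    by_cases hfx : far < f x
    · left
      have e : (fun x => (f x - max far (M - η * m)) / M)
          = fun x => 1 / M * f x + -(max far (M - η * m) / M) := by ext; ring
      rw [e, nbrAvg_affine hd0]
      have h1 := hsub x hx hfx
      have h2 : max far (M - η * m) ≤ max far (M - η * (m + 1 : ℕ)) + η := by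
        push_cast
        refine max_le (by linarith [le_max_left far (M - η * (m + 1))]) ?_
        linarith [le_max_right far (M - η * (m + 1))]
      have h3 : f x - max far (M - η * (m + 1 : ℕ)) ≤ nbrAvg f x - max far (M - η * m) := by
        linarith
      calc _ ≤ (nbrAvg f x - max far (M - η * m)) / M := div_le_div_of_nonneg_right h3 hM0.le
        _ = _ := by ring
    · right
      push Not at hfx
      refine div_nonpos_of_nonpos_of_nonneg ?_ hM0.le
      linarith [le_max_left far (M - η * (m + 1 : ℕ))]

lemma hitProb_le_succ (B : Set (Fin d → ℤ)) (m : ℕ) (y : Fin d → ℤ) :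
    hitProb B m y ≤ hitProb B (m + 1) y := by
  induction m generalizing y with
  | zero =>
    by_cases hy : y ∈ B
    · rw [hitProb_of_mem hy, hitProb_of_mem hy]
    · simpa [hitProb, hy] using hitProb_nonneg (B := B) 1 y
  | succ m ih =>
    by_cases hy : y ∈ B
    · rw [hitProb_of_mem hy, hitProb_of_mem hy]
    · rw [hitProb_succ hy, hitProb_succ hy]
      exact nbrAvg_mono fun i => ⟨ih _, ih _⟩

lemma hitProb_mono_time (B : Set (Fin d → ℤ)) (y : Fin d → ℤ) :
    Monotone (fun m => hitProb B m y) :=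
  monotone_nat_of_le_succ fun m => hitProb_le_succ B m y

/-- Following a shortest path to a point of `B`. -/
lemma pow_le_hitProb (hd : d ≠ 0) {B : Set (Fin d → ℤ)} {z : Fin d → ℤ} (hz : z ∈ B) (n : ℕ)
    (y : Fin d → ℤ) (hy : ∑ i, (y i - z i).natAbs ≤ n) :
    ((2 * (d : ℝ))⁻¹) ^ n ≤ hitProb B n y := by
  have hd1 : (1 : ℝ) ≤ d := by exact_mod_cast Nat.one_le_iff_ne_zero.2 hd
  induction n generalizing y with
  | zero =>
    have : y = z := by
      ext i
      have := Finset.sum_eq_zero_iff.1 (Nat.le_zero.1 hy) i (Finset.mem_univ i)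
      omega
    rw [hitProb_of_mem (this ▸ hz)]; simp
  | succ n ih =>
    by_cases hB : y ∈ B
    · rw [hitProb_of_mem hB]
      exact pow_le_one₀ (by positivity) (inv_le_one_of_one_le₀ (by linarith))
    obtain ⟨i, hi⟩ : ∃ i, y i ≠ z i := by
      by_contra hcon
      push Not at hcon
      exact hB ((funext hcon : y = z) ▸ hz)
    have hdist : ∀ e : ℤ, (y i + e - z i).natAbs + 1 = (y i - z i).natAbs →
        ∑ j, ((y + Pi.single i e : Fin d → ℤ) j - z j).natAbs ≤ n := by
      intro e he
      rw [← Finset.add_sum_erase _ _ (Finset.mem_univ i)] at hy ⊢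
      have : ∑ j ∈ Finset.univ.erase i, ((y + Pi.single i e : Fin d → ℤ) j - z j).natAbs
          = ∑ j ∈ Finset.univ.erase i, (y j - z j).natAbs :=
        Finset.sum_congr rfl fun j hj => by simp [(Finset.mem_erase.1 hj).1]
      rw [this]
      simp only [Pi.add_apply, Pi.single_eq_same]
      omega
    have hsingle : ∀ e : ℤ, (e = 1 ∨ e = -1) → ((2 * (d : ℝ))⁻¹) ^ n ≤
        hitProb B n (y + Pi.single i e) → ((2 * (d : ℝ))⁻¹) ^ (n + 1) ≤ nbrAvg (hitProb B n) y := by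
      intro e he h
      rw [nbrAvg, pow_succ, ← div_eq_mul_inv]
      refine div_le_div_of_nonneg_right ?_ (by positivity)
      refine le_trans ?_ (Finset.single_le_sum (f := fun i => hitProb B n (y + Pi.single i 1)
        + hitProb B n (y - Pi.single i 1))
        (fun j _ => add_nonneg (hitProb_nonneg _ _) (hitProb_nonneg _ _)) (Finset.mem_univ i))
      rcases he with rfl | rfl
      · exact h.trans (le_add_of_nonneg_right (hitProb_nonneg _ _))
      · rw [Pi.single_neg, ← sub_eq_add_neg] at h
        exact h.trans (le_add_of_nonneg_left (hitProb_nonneg _ _))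
    rw [hitProb_succ hB]
    rcases lt_or_gt_of_ne hi with h | h
    · exact hsingle 1 (Or.inl rfl) (ih _ (hdist 1 (by omega)))
    · exact hsingle (-1) (Or.inr rfl) (ih _ (hdist (-1) (by omega)))

/-- Entering `B` and then, from the entrance point, entering `A`. -/
lemma mul_hitProb_le_hitProb_add (hd : d ≠ 0) {A B : Set (Fin d → ℤ)} {κ : ℝ} (k : ℕ)
    (h : ∀ x ∈ B, κ ≤ hitProb A k x) (hκ : κ ≤ 1) (n : ℕ) (y : Fin d → ℤ) :
    κ * hitProb B n y ≤ hitProb A (n + k) y := by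
  induction n generalizing y with
  | zero =>
    by_cases hy : y ∈ B
    · rw [hitProb_of_mem hy, zero_add, mul_one]; exact h y hy
    · simpa [hitProb, hy] using hitProb_nonneg (B := A) k y
  | succ n ih =>
    by_cases hy : y ∈ B
    · rw [hitProb_of_mem hy, mul_one]
      exact (h y hy).trans (hitProb_mono_time A y (by omega))
    by_cases hA : y ∈ A
    · rw [hitProb_of_mem hA, hitProb_succ hy]
      have hle : ∀ n (x : Fin d → ℤ), hitProb B n x ≤ 1 := by
        intro n
        induction n with
        | zero => intro x; by_cases hx : x ∈ B <;> simp [hitProb, hx]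
        | succ n ih' =>
          intro x
          by_cases hx : x ∈ B
          · rw [hitProb_of_mem hx]
          · rw [hitProb_succ hx]
            have := nbrAvg_affine hd (hitProb B n) 0 1 x
            refine (nbrAvg_mono (g := fun x => 0 * hitProb B n x + 1) fun i => ?_).trans
              (by rw [this]; simp)
            simp [ih']
      rw [← hitProb_succ hy]
      nlinarith [hle (n + 1) y, hitProb_nonneg (B := B) (n + 1) y]
    · rw [show n + 1 + k = (n + k) + 1 by ring, hitProb_succ hy, hitProb_succ hA]
      have := nbrAvg_affine hd (hitProb B n) κ 0 y
      rw [add_zero] at this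
      rw [← this]
      exact nbrAvg_mono fun i => by simpa using ⟨ih _, ih _⟩

/-- The hitting estimate for balls of every radius: from distance at most `R` the ball of radius
`l` is entered within `C R ^ (d + 1)` steps with probability at least `c (l / R) ^ (d - 1)`. -/
lemma le_hitProb_latticeBall (hd : 2 ≤ d) :
    ∃ c C : ℝ, 0 < c ∧ 0 < C ∧ ∀ (l R : ℕ) (z y : Fin d → ℤ), 1 ≤ l → l ≤ R →
      latticeNormSq (y - z) ≤ (R : ℤ) ^ 2 → ∀ N : ℕ, C * (R : ℝ) ^ (d + 1) ≤ N →
      c * ((l : ℝ) / R) ^ (d - 1) ≤ hitProb (latticeBall z l) N y := by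
  obtain ⟨c, C, hc, hC, h⟩ := le_hitProb_largeBall hd
  have hd0 : d ≠ 0 := by omega
  have hd2 : (2 : ℝ) ≤ d := by exact_mod_cast hd
  set k : ℕ := (4 * d) ^ 2 with hk
  set κ : ℝ := ((2 * (d : ℝ))⁻¹) ^ k with hκ
  have hκ0 : 0 < κ := by positivity
  have hκ1 : κ ≤ 1 := pow_le_one₀ (by positivity) (inv_le_one_of_one_le₀ (by linarith))
  have hD1 : (1 : ℝ) ≤ (4 * d) ^ (d - 1) := one_le_pow₀ (by linarith)
  refine ⟨κ * c / (4 * d) ^ (d - 1), C * (4 * d) ^ (d + 1) + k, by positivity, by positivity, ?_⟩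
  intro l R z y hl hlR hy N hN
  have hR1 : (1 : ℝ) ≤ R := by exact_mod_cast hl.trans hlR
  have hRd : (1 : ℝ) ≤ (R : ℝ) ^ (d + 1) := one_le_pow₀ hR1
  by_cases hld : 4 * d ≤ l
  · refine le_trans ?_ (h l R z y hld hlR hy N (le_trans ?_ hN))
    · refine mul_le_mul_of_nonneg_right ?_ (by positivity)
      rw [div_le_iff₀ (by positivity)]
      nlinarith
    · refine mul_le_mul_of_nonneg_right ?_ (by positivity)
      have : (1 : ℝ) ≤ (4 * d) ^ (d + 1) := one_le_pow₀ (by linarith)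
      have : (0 : ℝ) ≤ k := by positivity
      nlinarith
  · push Not at hld
    have hkN : k ≤ N := by
      have : (k : ℝ) ≤ N := by
        refine le_trans ?_ hN
        have : 0 ≤ C * (4 * d) ^ (d + 1) * (R : ℝ) ^ (d + 1) := by positivity
        have : (k : ℝ) ≤ k * (R : ℝ) ^ (d + 1) := le_mul_of_one_le_right (by positivity) hRd
        linarith
      exact_mod_cast this
    obtain ⟨n, rfl⟩ : ∃ n, N = n + k := ⟨N - k, by omega⟩
    have h1 := h (4 * d) (4 * d * R) z y le_rfl
      (Nat.le_mul_of_pos_right _ (by omega)) (hy.trans (by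
        have : (1 : ℤ) ≤ 4 * d := by omega
        push_cast
        have : (R : ℤ) ≤ 4 * d * R := le_mul_of_one_le_left (by positivity) this
        exact pow_le_pow_left₀ (by positivity) this 2)) n (by
          push_cast at hN ⊢
          have : (k : ℝ) ≤ k * (R : ℝ) ^ (d + 1) := le_mul_of_one_le_right (by positivity) hRd
          rw [mul_pow]
          linarith)
    have h2 := mul_hitProb_le_hitProb_add hd0 (A := latticeBall z l)
      (B := latticeBall z (4 * d)) (κ := κ) k (fun x hx => by
        refine pow_le_hitProb hd0 (mem_latticeBall_self z hl) k x ?_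
        have hx' : latticeNormSq (x - z) < ((4 * d : ℕ) : ℤ) ^ 2 := hx
        have : ((∑ i, (x i - z i).natAbs : ℕ) : ℤ) ≤ latticeNormSq (x - z) := by
          rw [latticeNormSq]
          push_cast
          refine Finset.sum_le_sum fun i _ => ?_
          rw [← sq_abs, Pi.sub_apply]
          nlinarith [Int.le_self_sq |x i - z i|]
        have h3 : ((∑ i, (x i - z i).natAbs : ℕ) : ℤ) ≤ (k : ℕ) := by
          rw [hk]; push_cast at hx' this ⊢; linarith
        exact_mod_cast h3) hκ1 n y
    refine le_trans ?_ h2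
    have h3 := mul_le_mul_of_nonneg_left h1 hκ0.le
    refine le_trans ?_ h3
    push_cast
    have hl' : (l : ℝ) ≤ 4 * d := by exact_mod_cast hld.le
    have e1 : (4 * (d : ℝ)) / (4 * d * R) = 1 / R := by field_simp
    have e2 : ((l : ℝ) / R) ^ (d - 1) ≤ (4 * d) ^ (d - 1) * (1 / (R : ℝ)) ^ (d - 1) := by
      rw [← mul_pow, mul_one_div]
      gcongr
    rw [e1]
    calc κ * c / (4 * d) ^ (d - 1) * ((l : ℝ) / R) ^ (d - 1)
        ≤ κ * c / (4 * d) ^ (d - 1) * ((4 * d) ^ (d - 1) * (1 / (R : ℝ)) ^ (d - 1)) :=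
          mul_le_mul_of_nonneg_left e2 (by positivity)
      _ = _ := by field_simp

end ballHitting

/-! ### Layered exploration of the frog model -/

section layers

variable {d : ℕ} {Ω : Type*}

open Classical in
/-- The sites of the finite set `D` visited within `N` steps by one of the walks started in `W`. -/
noncomputable def nextVisited (S : (Fin d → ℤ) → ℕ → Ω → (Fin d → ℤ)) (N : ℕ)
    (D W : Finset (Fin d → ℤ)) (ω : Ω) : Finset (Fin d → ℤ) :=
  D.filter fun x => ∃ y ∈ W, ∃ n ≤ N, S y n ω = x

/-- The layered exploration of the frog model: the walk of the origin is run for `N` steps and wakes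
sites of the layer `D 1`, whose walks are run for `N` steps and wake sites of `D 2`, and so on. -/
noncomputable def visitedLayer (S : (Fin d → ℤ) → ℕ → Ω → (Fin d → ℤ)) (N : ℕ)
    (D : ℕ → Finset (Fin d → ℤ)) : ℕ → Ω → Finset (Fin d → ℤ)
  | 0, _ => {0}
  | k + 1, ω => nextVisited S N (D (k + 1)) (visitedLayer S N D k ω) ω

variable {S : (Fin d → ℤ) → ℕ → Ω → (Fin d → ℤ)} {N : ℕ} {D : ℕ → Finset (Fin d → ℤ)}

lemma mem_nextVisited {D W : Finset (Fin d → ℤ)} {ω : Ω} {x : Fin d → ℤ} :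
    x ∈ nextVisited S N D W ω ↔ x ∈ D ∧ ∃ y ∈ W, ∃ n ≤ N, S y n ω = x := by
  simp [nextVisited]

lemma visitedLayer_subset (hD : D 0 = {0}) (k : ℕ) (ω : Ω) : visitedLayer S N D k ω ⊆ D k := by
  cases k with
  | zero => simp [visitedLayer, hD]
  | succ k => exact fun x hx => (mem_nextVisited.1 hx).1

lemma hitTime_le {x z : Fin d → ℤ} {n : ℕ} {ω : Ω} (h : S x n ω = z) :
    hitTime S x z ω ≤ n :=
  iInf₂_le n h

/-- A site woken in the `k`-th layer is reached by a chain of `k` walks run for at most `N` steps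
each. -/
lemma passageTime_le_of_mem_visitedLayer {k : ℕ} {ω : Ω} {x : Fin d → ℤ}
    (hx : x ∈ visitedLayer S N D k ω) : passageTime S 0 x ω ≤ (k * N : ℕ) := by
  obtain ⟨p, h0, hk, hp⟩ : ∃ p : ℕ → (Fin d → ℤ), p 0 = 0 ∧ p k = x ∧
      ∀ i < k, hitTime S (p i) (p (i + 1)) ω ≤ N := by
    induction k generalizing x with
    | zero => exact ⟨fun _ => 0, rfl, by simpa [visitedLayer, eq_comm] using hx, by simp⟩
    | succ k ih =>
      obtain ⟨y, hy, n, hn, hS⟩ := (mem_nextVisited.1 hx).2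
      obtain ⟨p, h0, hk, hp⟩ := ih hy
      refine ⟨Function.update p (k + 1) x, by simp [h0], by simp, fun i hi => ?_⟩
      rcases Nat.lt_succ_iff_lt_or_eq.1 hi with h | rfl
      · rw [Function.update_of_ne (by omega), Function.update_of_ne (by omega)]
        exact hp i h
      · rw [Function.update_of_ne (by omega), Function.update_self, hk]
        exact (hitTime_le hS).trans (by exact_mod_cast hn)
  calc passageTime S 0 x ω
      ≤ ∑ i : Fin k, hitTime S (p i.castSucc) (p i.succ) ω :=
        iInf_le_of_le k (iInf_le_of_le (fun i => p i)
          (iInf₂_le (by simpa using h0) (by simpa using hk)))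
    _ ≤ ∑ _i : Fin k, (N : ℕ∞) := Finset.sum_le_sum fun i _ => by simpa using hp i i.2
    _ = (k * N : ℕ) := by simp

lemma measurableSet_finset_pred {α : Type*} [Countable α] {m : MeasurableSpace Ω}
    {V : Ω → Finset α} (h : ∀ x, MeasurableSet {ω | x ∈ V ω}) (P : Finset α → Prop) :
    MeasurableSet {ω | P (V ω)} := by
  have h1 : ∀ W, MeasurableSet {ω | V ω = W} := by
    intro W
    have : {ω | V ω = W} = ⋂ x, {ω | x ∈ V ω ↔ x ∈ W} := by ext; simp [Finset.ext_iff]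
    rw [this]
    refine MeasurableSet.iInter fun x => ?_
    by_cases hx : x ∈ W
    · simpa only [hx, iff_true] using h x
    · simp only [hx, iff_false]
      exact (h x).compl
  have : {ω | P (V ω)} = ⋃ W ∈ {W | P W}, {ω | V ω = W} := by ext; simp
  rw [this]
  exact MeasurableSet.biUnion (Set.to_countable _) fun W _ => h1 W

/-- The σ-algebra generated by the trajectories of the walks started in `U`. -/
abbrev walksFrom (S : (Fin d → ℤ) → ℕ → Ω → (Fin d → ℤ)) (U : Set (Fin d → ℤ)) :
    MeasurableSpace Ω :=
  ⨆ x ∈ U, MeasurableSpace.comap (fun ω (n : ℕ) => S x n ω) inferInstance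

lemma walksFrom_mono (S : (Fin d → ℤ) → ℕ → Ω → (Fin d → ℤ)) {U U' : Set (Fin d → ℤ)}
    (h : U ⊆ U') : walksFrom S U ≤ walksFrom S U' :=
  biSup_mono fun _ hx => h hx

lemma measurableSet_walksFrom_hit {U : Set (Fin d → ℤ)} {y : Fin d → ℤ} (hy : y ∈ U) (N : ℕ)
    (B : Set (Fin d → ℤ)) : MeasurableSet[walksFrom S U] {ω | ∃ n ≤ N, S y n ω ∈ B} := by
  have hle : MeasurableSpace.comap (fun ω (n : ℕ) => S y n ω) inferInstance ≤ walksFrom S U :=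
    le_iSup₂_of_le y hy le_rfl
  refine hle _ ⟨{f | ∃ n ≤ N, f n ∈ B}, ?_, rfl⟩
  have : {f : ℕ → (Fin d → ℤ) | ∃ n ≤ N, f n ∈ B} = ⋃ n ∈ Set.Iic N, (fun f => f n) ⁻¹' B := by
    ext; simp
  rw [this]
  exact MeasurableSet.biUnion (Set.to_countable _) fun n _ =>
    measurable_pi_apply n (Set.to_countable B).measurableSet

lemma measurableSet_mem_nextVisited {D W : Finset (Fin d → ℤ)} (x : Fin d → ℤ) :
    MeasurableSet[walksFrom S W] {ω | x ∈ nextVisited S N D W ω} := by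
  by_cases hx : x ∈ D
  · have : {ω | x ∈ nextVisited S N D W ω} =
        ⋃ y ∈ (W : Set (Fin d → ℤ)), {ω | ∃ n ≤ N, S y n ω ∈ ({x} : Set (Fin d → ℤ))} := by
      ext; simp [mem_nextVisited, hx]
    rw [this]
    exact MeasurableSet.biUnion (Set.to_countable _) fun y hy => measurableSet_walksFrom_hit hy N _
  · have : {ω | x ∈ nextVisited S N D W ω} = ∅ := by ext; simp [mem_nextVisited, hx]
    rw [this]; exact @MeasurableSet.empty _ (_)

/-- The first `k` layers of the exploration only use walks started in the layers below `k`. -/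
lemma measurableSet_mem_visitedLayer (hD : D 0 = {0}) (k : ℕ) (x : Fin d → ℤ) :
    MeasurableSet[walksFrom S {y | ∃ i < k, y ∈ D i}] {ω | x ∈ visitedLayer S N D k ω} := by
  induction k generalizing x with
  | zero => by_cases hx : x = 0 <;> simp [visitedLayer, hx]
  | succ k ih =>
    by_cases hx : x ∈ D (k + 1)
    · have : {ω | x ∈ visitedLayer S N D (k + 1) ω} =
          ⋃ y ∈ (D k : Set (Fin d → ℤ)), {ω | y ∈ visitedLayer S N D k ω} ∩
            {ω | ∃ n ≤ N, S y n ω ∈ ({x} : Set (Fin d → ℤ))} := by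
        ext ω
        simp only [visitedLayer, Set.mem_ofPred_eq, mem_nextVisited, hx, true_and, Set.mem_iUnion,
          Set.mem_inter_iff, Set.mem_singleton_iff]
        constructor
        · rintro ⟨y, hy, h⟩
          exact ⟨y, visitedLayer_subset hD k ω hy, hy, h⟩
        · rintro ⟨y, -, hy, h⟩
          exact ⟨y, hy, h⟩
      rw [this]
      refine MeasurableSet.biUnion (Set.to_countable _) fun y hy => MeasurableSet.inter ?_ ?_
      · have hle : walksFrom S {y | ∃ i < k, y ∈ D i} ≤ walksFrom S {y | ∃ i < k + 1, y ∈ D i} :=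
          walksFrom_mono S fun z hz => by
            obtain ⟨i, hi, hz⟩ := hz
            exact ⟨i, by omega, hz⟩
        exact hle _ (ih y)
      · exact measurableSet_walksFrom_hit (show ∃ i < k + 1, y ∈ D i from ⟨k, by omega, hy⟩) N _
    · have : {ω | x ∈ visitedLayer S N D (k + 1) ω} = ∅ := by
        ext; simp [visitedLayer, mem_nextVisited, hx]
      rw [this]; exact @MeasurableSet.empty _ (_)

variable [MeasurableSpace Ω] {μ : Measure Ω}

lemma IsFrogFamily.measurable_walk (hF : IsFrogFamily μ S) (x : Fin d → ℤ) :
    Measurable (fun ω (n : ℕ) => S x n ω) :=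
  measurable_pi_lambda _ fun n => (hF.srw x).measurable n

lemma IsFrogFamily.walksFrom_le (hF : IsFrogFamily μ S) (U : Set (Fin d → ℤ)) :
    walksFrom S U ≤ ‹MeasurableSpace Ω› :=
  iSup₂_le fun x _ => (hF.measurable_walk x).comap_le

lemma IsFrogFamily.real_inter (hF : IsFrogFamily μ S) {U U' : Set (Fin d → ℤ)}
    (hU : Disjoint U U') {E E' : Set Ω} (hE : MeasurableSet[walksFrom S U] E)
    (hE' : MeasurableSet[walksFrom S U'] E') : μ.real (E ∩ E') = μ.real E * μ.real E' := by
  have hi := indep_iSup_of_disjoint (fun x => (hF.measurable_walk x).comap_le) hF.indep hU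
  have := (Indep_iff _ _ μ).1 hi E E' hE hE'
  simp only [measureReal_def, this, ENNReal.toReal_mul]

variable [IsProbabilityMeasure μ]

/-- As the layers are disjoint, the walks which explore from layer `k` are independent of the set
of sites woken in layer `k`. Hence the failure probabilities of the single stages, each started
from a deterministic good set, add up. -/
lemma IsFrogFamily.real_not_visitedLayer_le (hF : IsFrogFamily μ S) (hD : D 0 = {0}) {K : ℕ}
    (hdisj : ∀ k < K, ∀ i < k, Disjoint (D i) (D k)) (G : ℕ → Finset (Fin d → ℤ) → Prop)
    (hG : G 0 {0}) (δ : ℕ → ℝ) (hδ0 : ∀ k, 0 ≤ δ k)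
    (hδ : ∀ k < K, ∀ W ⊆ D k, G k W →
      μ.real {ω | ¬ G (k + 1) (nextVisited S N (D (k + 1)) W ω)} ≤ δ k) :
    μ.real {ω | ¬ G K (visitedLayer S N D K ω)} ≤ ∑ k ∈ Finset.range K, δ k := by
  classical
  have main : ∀ k ≤ K, μ.real {ω | ¬ G k (visitedLayer S N D k ω)} ≤
      ∑ i ∈ Finset.range k, δ i := by
    intro k
    induction k with
    | zero => intro _; simp [visitedLayer, hG]
    | succ k ih =>
      intro hk
      rw [Finset.sum_range_succ]
      set 𝒲 := (D k).powerset.filter (G k) with h𝒲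
      set E : Finset (Fin d → ℤ) → Set Ω := fun W => {ω | visitedLayer S N D k ω = W} with hE
      set F : Finset (Fin d → ℤ) → Set Ω :=
        fun W => {ω | ¬ G (k + 1) (nextVisited S N (D (k + 1)) W ω)} with hFdef
      have hEm : ∀ W, MeasurableSet[walksFrom S {y | ∃ i < k, y ∈ D i}] (E W) := fun W =>
        measurableSet_finset_pred (measurableSet_mem_visitedLayer hD k) (fun V => V = W)
      have hFm : ∀ W : Finset (Fin d → ℤ), MeasurableSet[walksFrom S (W : Set _)] (F W) := fun W =>
        measurableSet_finset_pred (fun x => measurableSet_mem_nextVisited x)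
          (fun V => ¬ G (k + 1) V)
      have hcover : {ω | ¬ G (k + 1) (visitedLayer S N D (k + 1) ω)} ⊆
          {ω | ¬ G k (visitedLayer S N D k ω)} ∪ ⋃ W ∈ 𝒲, E W ∩ F W := by
        intro ω hω
        by_cases hg : G k (visitedLayer S N D k ω)
        · right
          refine Set.mem_biUnion (x := visitedLayer S N D k ω) ?_ ⟨rfl, hω⟩
          simp only [h𝒲, Finset.coe_filter, Finset.mem_powerset, Set.mem_ofPred_eq]
          exact ⟨visitedLayer_subset hD k ω, hg⟩
        · exact Or.inl hg
      refine (measureReal_mono hcover (measure_ne_top _ _)).trans ((measureReal_union_le _ _).trans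
        (add_le_add (ih (by omega)) ?_))
      refine (measureReal_biUnion_finset_le _ _).trans ?_
      have hterm : ∀ W ∈ 𝒲, μ.real (E W ∩ F W) ≤ μ.real (E W) * δ k := by
        intro W hW
        obtain ⟨hWD, hWG⟩ := Finset.mem_filter.1 hW
        have hWD := Finset.mem_powerset.1 hWD
        have hdis : Disjoint {y | ∃ i < k, y ∈ D i} (W : Set (Fin d → ℤ)) := by
          rw [Set.disjoint_left]
          rintro y ⟨i, hi, hy⟩ hyW
          exact Finset.disjoint_left.1 (hdisj k (by omega) i hi) hy (hWD hyW)
        rw [hF.real_inter hdis (hEm W) (hFm W)]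
        exact mul_le_mul_of_nonneg_left (hδ k (by omega) W hWD hWG) measureReal_nonneg
      refine (Finset.sum_le_sum hterm).trans ?_
      rw [← Finset.sum_mul]
      have hsum : ∑ W ∈ 𝒲, μ.real (E W) ≤ 1 := by
        rw [← measureReal_biUnion_finset (f := E)]
        · exact measureReal_le_one
        · intro W _ W' _ hne
          exact Set.disjoint_left.2 fun ω h h' => hne (h.symm.trans h')
        · exact fun W _ => hF.walksFrom_le _ _ (hEm W)
      exact mul_le_of_le_one_left (hδ0 k) hsum
  exact main K le_rfl

/-- Independent walks started from at least `M` sites, each entering each of finitely many targets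
with probability at least `p`, jointly enter all the targets with high probability. -/
lemma IsFrogFamily.real_not_forall_hit_le (hF : IsFrogFamily μ S) {ι : Type*} (J : Finset ι)
    (B : ι → Set (Fin d → ℤ)) {D W : Finset (Fin d → ℤ)} {p M : ℝ} (hp : 0 ≤ p)
    (hD : ∀ j ∈ J, ∀ x ∈ B j, x ∈ D) (hM : M ≤ W.card)
    (hhit : ∀ y ∈ W, ∀ j ∈ J, p ≤ hitProb (B j) N y) :
    μ.real {ω | ¬ ∀ j ∈ J, ∃ x ∈ nextVisited S N D W ω, x ∈ B j} ≤
      J.card * Real.exp (-(p * M)) := by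
  have hcover : {ω | ¬ ∀ j ∈ J, ∃ x ∈ nextVisited S N D W ω, x ∈ B j} ⊆
      ⋃ j ∈ J, ⋂ y ∈ W, {ω | ∃ n ≤ N, S y n ω ∈ B j}ᶜ := by
    intro ω hω
    simp only [Set.mem_ofPred_eq, not_forall] at hω
    obtain ⟨j, hj, h⟩ := hω
    refine Set.mem_biUnion hj (Set.mem_iInter₂.2 fun y hy hh => h ?_)
    obtain ⟨n, hn, hb⟩ := hh
    exact ⟨S y n ω, mem_nextVisited.2 ⟨hD j hj _ hb, y, hy, n, hn, rfl⟩, hb⟩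
  refine (measureReal_mono hcover (measure_ne_top _ _)).trans
    ((measureReal_biUnion_finset_le _ _).trans ?_)
  rw [← nsmul_eq_mul]
  refine Finset.sum_le_card_nsmul _ _ _ fun j hj => ?_
  have hind := hF.indep.measure_inter_preimage_eq_mul W
    (sets := fun _ => {f : ℕ → (Fin d → ℤ) | ∃ n ≤ N, f n ∈ B j}ᶜ) (fun y _ => by
      have : {f : ℕ → (Fin d → ℤ) | ∃ n ≤ N, f n ∈ B j} =
          ⋃ n ∈ Set.Iic N, (fun f => f n) ⁻¹' B j := by ext; simp
      rw [this]
      exact (MeasurableSet.biUnion (Set.to_countable _) fun n _ =>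
        measurable_pi_apply n (Set.to_countable (B j)).measurableSet).compl)
  have hreal : μ.real (⋂ y ∈ W, {ω | ∃ n ≤ N, S y n ω ∈ B j}ᶜ) =
      ∏ y ∈ W, μ.real {ω | ∃ n ≤ N, S y n ω ∈ B j}ᶜ := by
    simp only [measureReal_def, ← ENNReal.toReal_prod]
    congr 1
  rw [hreal]
  calc ∏ y ∈ W, μ.real {ω | ∃ n ≤ N, S y n ω ∈ B j}ᶜ ≤ ∏ y ∈ W, Real.exp (-p) := by
        refine Finset.prod_le_prod (fun _ _ => measureReal_nonneg) fun y hy => ?_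
        rw [probReal_compl_eq_one_sub ((hF.srw y).measurableSet_hit (B j) N)]
        have h1 := (hF.srw y).hitProb_le (B j) N
        have h2 := hhit y hy j hj
        have h3 := Real.one_sub_le_exp_neg p
        linarith
    _ = Real.exp (-(p * W.card)) := by
        rw [Finset.prod_const, ← Real.exp_nat_mul]; congr 1; ring
    _ ≤ Real.exp (-(p * M)) := Real.exp_le_exp.2 (by nlinarith)

/-- The coordinate `i` of a nearest-neighbour path started at the origin takes, in absolute value,
all values up to the one it has reached. -/
lemma exists_abs_eq_of_steps {f : ℕ → (Fin d → ℤ)} (h0 : f 0 = 0)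
    (hf : ∀ n, ∃ p, f (n + 1) = f n + unitStep p) (i : Fin d) {a n : ℕ} (ha : (a : ℤ) ≤ |f n i|) :
    ∃ k ≤ n, |f k i| = a := by
  induction n with
  | zero =>
    refine ⟨0, le_rfl, ?_⟩
    simp [h0] at ha ⊢; omega
  | succ n ih =>
    by_cases h : (a : ℤ) ≤ |f n i|
    · obtain ⟨k, hk, e⟩ := ih h
      exact ⟨k, by omega, e⟩
    · refine ⟨n + 1, le_rfl, ?_⟩
      obtain ⟨p, hp⟩ := hf n
      have h1 : |unitStep p i| ≤ 1 := by
        unfold unitStep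
        split_ifs <;> by_cases hi : i = p.1 <;> simp [hi]
      have h2 : |f (n + 1) i| ≤ |f n i| + |unitStep p i| := by rw [hp]; exact abs_add_le _ _
      omega

lemma abs_le_of_steps {f : ℕ → (Fin d → ℤ)} (h0 : f 0 = 0)
    (hf : ∀ n, ∃ p, f (n + 1) = f n + unitStep p) (i : Fin d) (n : ℕ) : |f n i| ≤ n := by
  induction n with
  | zero => simp [h0]
  | succ n ih =>
    obtain ⟨p, hp⟩ := hf n
    have h1 : |unitStep p i| ≤ 1 := by
      unfold unitStep
      split_ifs <;> by_cases hi : i = p.1 <;> simp [hi]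
    have h2 : |f (n + 1) i| ≤ |f n i| + |unitStep p i| := by rw [hp]; exact abs_add_le _ _
    push_cast; omega

/-- The walk of the origin visits, within `r` steps, a site at each of the heights `1, …, ρ`
(measured by the absolute value of the coordinate `i`), except with small probability. -/
lemma IsFrogFamily.real_not_slab_le (hF : IsFrogFamily μ S) (hd : d ≠ 0) (i : Fin d) {ρ r : ℕ}
    (hρ : 1 ≤ ρ) (hrN : r ≤ N) {D : Finset (Fin d → ℤ)}
    (hD : ∀ x : Fin d → ℤ, (∀ k, |x k| ≤ r) → 1 ≤ |x i| → |x i| ≤ ρ → x ∈ D) :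
    μ.real {ω | ¬ ∀ j ∈ Finset.range ρ, ∃ x ∈ nextVisited S N D {0} ω, |x i| = (j + 1 : ℕ)} ≤
      2 * Real.exp (-(r / (2 * d * (ρ : ℝ) ^ 2))) := by
  set H : Set Ω := {ω | ∃ n ≤ r, S 0 n ω ∈ {y : Fin d → ℤ | (ρ : ℤ) ≤ |y i|}} with hH
  have h1 : 1 - 2 * Real.exp (-(r / (2 * d * (ρ : ℝ) ^ 2))) ≤ μ.real H :=
    (one_sub_le_hitProb_slab hd i hρ r).trans ((hF.srw 0).hitProb_le _ r)
  have h2 : μ.real Hᶜ = 1 - μ.real H :=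
    probReal_compl_eq_one_sub ((hF.srw 0).measurableSet_hit _ r)
  have h3 : {ω | ¬ ∀ j ∈ Finset.range ρ, ∃ x ∈ nextVisited S N D {0} ω, |x i| = (j + 1 : ℕ)}
      ≤ᵐ[μ] Hᶜ := by
    filter_upwards [(hF.srw 0).ae_step hd] with ω hω hbad
    refine fun hHω => hbad fun j hj => ?_
    obtain ⟨n, hn, hy⟩ := hHω
    have hj' := Finset.mem_range.1 hj
    obtain ⟨k, hk, e⟩ := exists_abs_eq_of_steps (f := fun n => S 0 n ω) ((hF.srw 0).start ω) hω i
      (a := j + 1) (n := n) (le_trans (by exact_mod_cast hj') hy)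
    refine ⟨S 0 k ω, mem_nextVisited.2 ⟨hD _ (fun l => ?_) ?_ ?_, 0, by simp, k, by omega, rfl⟩, e⟩
    · exact (abs_le_of_steps (f := fun n => S 0 n ω) ((hF.srw 0).start ω) hω l k).trans
        (by exact_mod_cast hk.trans hn)
    · rw [e]; push_cast; omega
    · rw [e]; exact_mod_cast hj'
  have h4 : μ.real {ω | ¬ ∀ j ∈ Finset.range ρ, ∃ x ∈ nextVisited S N D {0} ω,
      |x i| = (j + 1 : ℕ)} ≤ μ.real Hᶜ :=
    ENNReal.toReal_mono (measure_ne_top _ _) (measure_mono_ae h3)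
  linarith

end layers

/-! ### Geometry of the layers -/

section geometry

variable {d : ℕ}

lemma abs_sub_lt_of_mem_latticeBall {x z : Fin d → ℤ} {l : ℕ} (h : x ∈ latticeBall z l)
    (i : Fin d) : |x i - z i| < l := by
  have h1 : (x i - z i) ^ 2 < (l : ℤ) ^ 2 := (sq_le_latticeNormSq (x - z) i).trans_lt h
  exact abs_lt_of_sq_lt_sq h1 (by positivity)

lemma finite_latticeBall (z : Fin d → ℤ) (l : ℕ) : (latticeBall z l).Finite := by
  refine (Set.Finite.pi' (ι := Fin d) (κ := fun _ => ℤ)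
    fun i => Set.finite_Icc (z i - (l : ℤ)) (z i + l)).subset fun x hx i => ?_
  have := abs_lt.1 (abs_sub_lt_of_mem_latticeBall hx i)
  exact ⟨by linarith, by linarith⟩

lemma latticeNormSq_sub_le {x z : Fin d → ℤ} {B : ℤ} (hd : 1 ≤ d) (hx : ∀ i, |x i| ≤ B)
    (hz : ∀ i, |z i| ≤ B) : latticeNormSq (x - z) ≤ (2 * d * B) ^ 2 := by
  have hB : 0 ≤ B := (abs_nonneg _).trans (hx ⟨0, hd⟩)
  have h1 : ∀ i, (x - z) i ^ 2 ≤ (2 * B) ^ 2 := by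
    intro i
    refine sq_le_sq' ?_ ?_ <;>
    · have := abs_le.1 (hx i)
      have := abs_le.1 (hz i)
      simp only [Pi.sub_apply]; linarith
  have h2 : latticeNormSq (x - z) ≤ d * (2 * B) ^ 2 := by
    refine (Finset.sum_le_sum fun i _ => h1 i).trans ?_
    simp
  have hd' : (1 : ℤ) ≤ d := by exact_mod_cast hd
  nlinarith [mul_nonneg (sub_nonneg.2 hd') (sq_nonneg (2 * B))]

lemma card_le_of_forall_exists_mem {ι α : Type*} {J : Finset ι} {W : Finset α} {B : ι → Set α}
    (hB : ∀ j ∈ J, ∀ j' ∈ J, j ≠ j' → Disjoint (B j) (B j'))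
    (h : ∀ j ∈ J, ∃ x ∈ W, x ∈ B j) : J.card ≤ W.card := by
  rcases J.eq_empty_or_nonempty with rfl | ⟨j₀, hj₀⟩
  · simp
  have : Nonempty α := ⟨(h j₀ hj₀).choose⟩
  choose! f hfW hfB using h
  refine Finset.card_le_card_of_injOn f hfW fun j hj j' hj' he => ?_
  by_contra hne
  exact Set.disjoint_left.1 (hB j hj j' hj' hne) (hfB j hj) (he ▸ hfB j' hj')

end geometry

/-- With scale parameter `L`, the layers live in a region of diameter of order `L ^ outerExp d`.
This is the cube of the number `L ^ (d ^ 2 + 1)` of sites to be woken by the first walk, and leaves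
that walk the time to do so. -/
abbrev outerExp (d : ℕ) : ℕ := 3 * (d ^ 2 + 1)

/-- The `k`-th target layer is a grid of `L ^ gridExp d k` balls in each direction. -/
def gridExp (d k : ℕ) : ℕ := min (d + 1 + k) (outerExp d)

/-- The index of the finest grid, the balls of which are single sites: the first `k` for which
`gridExp d k` reaches `outerExp d`. -/
def lastGrid (d : ℕ) : ℕ := outerExp d - (d + 1)

/-- The radius of the target balls of the `k`-th grid. -/
def targetRadius (d L k : ℕ) : ℕ := L ^ (outerExp d - gridExp d k)

/-- The index set of the targets of the `k`-th target layer: a grid up to `k = lastGrid d`, then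
a single final target. -/
def targetIndex (d L k : ℕ) : Finset (Fin d → ℕ) :=
  if k ≤ lastGrid d then Fintype.piFinset fun _ => Finset.range (L ^ gridExp d k) else {0}

/-- The centres of the target balls. The grids are shifted in direction `i₀` by different multiples
of `L ^ outerExp d`, which makes them disjoint; the final target is `x₀`. -/
def targetCentre {d : ℕ} (i₀ : Fin d) (x₀ : Fin d → ℤ) (L k : ℕ) (j : Fin d → ℕ) : Fin d → ℤ :=
  if k ≤ lastGrid d then
    fun i => 2 * (targetRadius d L k : ℤ) * j i +
      if i = i₀ then 10 * (k + 1) * (L : ℤ) ^ outerExp d else 0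
  else x₀

/-- The layers of sites: the origin, a slab in which the first walk wakes many sites, the unions of
the grid balls, and the final target. -/
noncomputable def frogLayer {d : ℕ} (i₀ : Fin d) (x₀ : Fin d → ℤ) (L : ℕ) :
    ℕ → Finset (Fin d → ℤ)
  | 0 => {0}
  | 1 => (Fintype.piFinset fun _ =>
      Finset.Icc (-(L : ℤ) ^ outerExp d) ((L : ℤ) ^ outerExp d)).filter
      fun x => 1 ≤ |x i₀| ∧ |x i₀| ≤ (L : ℤ) ^ (d ^ 2 + 1)
  | k + 2 => (targetIndex d L k).biUnion fun j =>
      (finite_latticeBall (targetCentre i₀ x₀ L k j) (targetRadius d L k)).toFinset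

/-- The set of woken sites of a layer is good if it meets all the heights of the slab, respectively
all the target balls. -/
def IsGoodLayer {d : ℕ} (i₀ : Fin d) (x₀ : Fin d → ℤ) (L : ℕ) : ℕ → Finset (Fin d → ℤ) → Prop
  | 0, W => W = {0}
  | 1, W => ∀ j ∈ Finset.range (L ^ (d ^ 2 + 1)), ∃ x ∈ W, |x i₀| = (j + 1 : ℕ)
  | k + 2, W => ∀ j ∈ targetIndex d L k, ∃ x ∈ W,
      x ∈ latticeBall (targetCentre i₀ x₀ L k j) (targetRadius d L k)

section frogLayer

variable {d : ℕ} {i₀ : Fin d} {x₀ : Fin d → ℤ} {L : ℕ}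

lemma gridExp_eq_outerExp {k : ℕ} (hk : lastGrid d ≤ k) :
    gridExp d k = outerExp d := by
  unfold gridExp
  unfold lastGrid at hk
  refine min_eq_right ?_
  omega

lemma gridExp_le (d k : ℕ) : gridExp d k ≤ outerExp d := min_le_right _ _

lemma targetRadius_mul (d L k : ℕ) : targetRadius d L k * L ^ gridExp d k = L ^ outerExp d := by
  rw [targetRadius, ← pow_add, Nat.sub_add_cancel (gridExp_le d k)]

lemma one_le_targetRadius (hL : 1 ≤ L) (k : ℕ) : 1 ≤ targetRadius d L k := Nat.one_le_pow _ _ hL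

lemma targetRadius_le (hL : 1 ≤ L) (k : ℕ) : targetRadius d L k ≤ L ^ outerExp d :=
  Nat.pow_le_pow_right hL (Nat.sub_le _ _)

lemma card_targetIndex_le (hL : 1 ≤ L) (k : ℕ) :
    (targetIndex d L k).card ≤ L ^ (outerExp d * d) := by
  unfold targetIndex
  split_ifs
  · rw [Fintype.card_piFinset_const, Finset.card_range, ← pow_mul]
    exact Nat.pow_le_pow_right hL (Nat.mul_le_mul_right _ (gridExp_le d k))
  · simpa using Nat.one_le_pow _ _ hL

/-- Coordinates of the centres of the grid balls. -/
lemma targetCentre_bounds {k : ℕ} (hk : k ≤ lastGrid d) {j : Fin d → ℕ}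
    (hj : j ∈ targetIndex d L k) (i : Fin d) :
    (if i = i₀ then 10 * (k + 1) * (L : ℤ) ^ outerExp d else 0) ≤ targetCentre i₀ x₀ L k j i ∧
    targetCentre i₀ x₀ L k j i ≤
      (if i = i₀ then 10 * (k + 1) * (L : ℤ) ^ outerExp d else 0) + 2 * (L : ℤ) ^ outerExp d := by
  simp only [targetIndex, if_pos hk, Fintype.mem_piFinset, Finset.mem_range] at hj
  have h1 : targetRadius d L k * j i ≤ L ^ outerExp d := by
    rw [← targetRadius_mul d L k]
    exact Nat.mul_le_mul_left _ (hj i).le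
  have h2 : (targetRadius d L k : ℤ) * j i ≤ (L : ℤ) ^ outerExp d := by exact_mod_cast h1
  have h3 : (0 : ℤ) ≤ (targetRadius d L k : ℤ) * j i := by positivity
  simp only [targetCentre, if_pos hk]
  constructor <;> nlinarith

/-- The multiple of `L ^ outerExp d` which bounds all the coordinates of all the layers. -/
abbrev boxFactor (d : ℕ) : ℕ := 10 * lastGrid d + 20

lemma abs_targetCentre_le (hL : 1 ≤ L) (hx₀ : ∀ i, |x₀ i| ≤ L) {k : ℕ} {j : Fin d → ℕ}
    (hj : j ∈ targetIndex d L k) (i : Fin d) :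
    |targetCentre i₀ x₀ L k j i| ≤ boxFactor d * (L : ℤ) ^ outerExp d := by
  have hL' : (1 : ℤ) ≤ L := by exact_mod_cast hL
  have hr : (1 : ℤ) ≤ (L : ℤ) ^ outerExp d := one_le_pow₀ hL'
  by_cases hk : k ≤ lastGrid d
  · obtain ⟨h1, h2⟩ := targetCentre_bounds (i₀ := i₀) (x₀ := x₀) hk hj i
    have hk' : (k : ℤ) ≤ lastGrid d := by exact_mod_cast hk
    have h3 : 10 * ((k : ℤ) + 1) * (L : ℤ) ^ outerExp d
        ≤ (10 * lastGrid d + 10) * (L : ℤ) ^ outerExp d := by nlinarith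
    have h4 : (0 : ℤ) ≤ 10 * ((k : ℤ) + 1) * (L : ℤ) ^ outerExp d := by positivity
    rw [abs_le]
    push_cast
    split_ifs at h1 h2 <;> constructor <;> nlinarith
  · simp only [targetCentre, if_neg hk]
    have h1 : (L : ℤ) ≤ (L : ℤ) ^ outerExp d := le_self_pow₀ hL' (by positivity)
    refine (hx₀ i).trans (h1.trans ?_)
    push_cast
    have : (0 : ℤ) ≤ lastGrid d := by positivity
    nlinarith

lemma mem_frogLayer_add_two {k : ℕ} {x : Fin d → ℤ} : x ∈ frogLayer i₀ x₀ L (k + 2) ↔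
    ∃ j ∈ targetIndex d L k, x ∈ latticeBall (targetCentre i₀ x₀ L k j) (targetRadius d L k) := by
  simp [frogLayer]

lemma mem_frogLayer_one {x : Fin d → ℤ} : x ∈ frogLayer i₀ x₀ L 1 ↔
    (∀ i, |x i| ≤ (L : ℤ) ^ outerExp d) ∧ 1 ≤ |x i₀| ∧ |x i₀| ≤ (L : ℤ) ^ (d ^ 2 + 1) := by
  simp [frogLayer, abs_le]

lemma abs_le_of_mem_frogLayer (hL : 1 ≤ L) {k : ℕ} (hk : k ≤ lastGrid d + 1) {x : Fin d → ℤ}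
    (hx : x ∈ frogLayer i₀ x₀ L (k + 1)) (i : Fin d) :
    |x i| ≤ boxFactor d * (L : ℤ) ^ outerExp d := by
  have hL' : (1 : ℤ) ≤ L := by exact_mod_cast hL
  have hr : (1 : ℤ) ≤ (L : ℤ) ^ outerExp d := one_le_pow₀ hL'
  have hK : (0 : ℤ) ≤ lastGrid d := by positivity
  rcases k with _ | k
  · refine ((mem_frogLayer_one.1 hx).1 i).trans ?_
    push_cast
    nlinarith
  · obtain ⟨j, hj, hb⟩ := mem_frogLayer_add_two.1 hx
    have hk1 : k ≤ lastGrid d := by omega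
    obtain ⟨h1, h2⟩ := targetCentre_bounds (i₀ := i₀) (x₀ := x₀) hk1 hj i
    have hk' : (k : ℤ) ≤ lastGrid d := by exact_mod_cast hk1
    have h3 : 10 * ((k : ℤ) + 1) * (L : ℤ) ^ outerExp d
        ≤ (10 * lastGrid d + 10) * (L : ℤ) ^ outerExp d := by nlinarith
    have h4 : (0 : ℤ) ≤ 10 * ((k : ℤ) + 1) * (L : ℤ) ^ outerExp d := by positivity
    have h5 := abs_lt.1 (abs_sub_lt_of_mem_latticeBall hb i)
    have h6 : (targetRadius d L k : ℤ) ≤ (L : ℤ) ^ outerExp d := by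
      exact_mod_cast targetRadius_le hL k
    rw [abs_le]
    push_cast
    split_ifs at h1 h2 <;> constructor <;> nlinarith

/-- The grid layers lie in disjoint slabs orthogonal to the direction `i₀`. -/
lemma coord_mem_of_mem_frogLayer (hL : 1 ≤ L) {k : ℕ} (hk : k ≤ lastGrid d) {x : Fin d → ℤ}
    (hx : x ∈ frogLayer i₀ x₀ L (k + 2)) :
    (10 * k + 9) * (L : ℤ) ^ outerExp d < x i₀ ∧ x i₀ < (10 * k + 13) * (L : ℤ) ^ outerExp d := by
  obtain ⟨j, hj, hb⟩ := mem_frogLayer_add_two.1 hx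
  obtain ⟨h1, h2⟩ := targetCentre_bounds (i₀ := i₀) (x₀ := x₀) hk hj i₀
  have h5 := abs_lt.1 (abs_sub_lt_of_mem_latticeBall hb i₀)
  have h6 : (targetRadius d L k : ℤ) ≤ (L : ℤ) ^ outerExp d := by
    exact_mod_cast targetRadius_le hL k
  simp only [if_true] at h1 h2
  constructor <;> nlinarith

lemma disjoint_frogLayer (hL : 1 ≤ L) {k i : ℕ} (hk : k < lastGrid d + 3) (hi : i < k) :
    Disjoint (frogLayer i₀ x₀ L i) (frogLayer i₀ x₀ L k) := by
  have hL' : (1 : ℤ) ≤ L := by exact_mod_cast hL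
  have hr : (1 : ℤ) ≤ (L : ℤ) ^ outerExp d := one_le_pow₀ hL'
  rw [Finset.disjoint_left]
  intro x hxi hxk
  rcases k with _ | _ | k
  · omega
  · obtain rfl : i = 0 := by omega
    have : x = 0 := by simpa [frogLayer] using hxi
    have h := (mem_frogLayer_one.1 hxk).2.1
    simp [this] at h
  · have h := coord_mem_of_mem_frogLayer hL (by omega) hxk
    have hk0 : (0 : ℤ) ≤ k := by positivity
    rcases i with _ | _ | i
    · have : x = 0 := by simpa [frogLayer] using hxi
      simp only [this, Pi.zero_apply] at h
      nlinarith
    · have h1 := (abs_le.1 ((mem_frogLayer_one.1 hxi).1 i₀)).2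
      nlinarith
    · have h1 := coord_mem_of_mem_frogLayer hL (by omega) hxi
      have h2 : (i : ℤ) + 1 ≤ k := by exact_mod_cast (by omega : i + 1 ≤ k)
      nlinarith

/-- The exponent of the number of walks available for the `k`-th target layer. -/
def sourceExp (d k : ℕ) : ℕ := if k = 0 then d ^ 2 + 1 else d * gridExp d (k - 1)

lemma le_card_of_isGoodLayer {k : ℕ} (hk : k ≤ lastGrid d + 1)
    {W : Finset (Fin d → ℤ)} (h : IsGoodLayer i₀ x₀ L (k + 1) W) :
    L ^ sourceExp d k ≤ W.card := by
  rcases k with _ | k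
  · have := card_le_of_forall_exists_mem (J := Finset.range (L ^ (d ^ 2 + 1))) (W := W)
      (B := fun j => {x : Fin d → ℤ | |x i₀| = (j + 1 : ℕ)}) (fun j _ j' _ hne => by
        refine Set.disjoint_left.2 fun x hx hx' => hne ?_
        have : ((j + 1 : ℕ) : ℤ) = (j' + 1 : ℕ) := hx.symm.trans hx'
        omega) h
    simpa [sourceExp] using this
  · have hk1 : k ≤ lastGrid d := by omega
    have := card_le_of_forall_exists_mem (J := targetIndex d L k) (W := W)
      (B := fun j => latticeBall (targetCentre i₀ x₀ L k j) (targetRadius d L k))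
      (fun j _ j' _ hne => by
        refine Set.disjoint_left.2 fun x hx hx' => ?_
        obtain ⟨i, hi⟩ := Function.ne_iff.1 hne
        have h1 := abs_lt.1 (abs_sub_lt_of_mem_latticeBall hx i)
        have h2 := abs_lt.1 (abs_sub_lt_of_mem_latticeBall hx' i)
        simp only [targetCentre, if_pos hk1] at h1 h2
        have h3 : (0 : ℤ) ≤ targetRadius d L k := by positivity
        rcases lt_or_gt_of_ne hi with h | h
        · have : (j i : ℤ) + 1 ≤ j' i := by exact_mod_cast h
          nlinarith
        · have : (j' i : ℤ) + 1 ≤ j i := by exact_mod_cast h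
          nlinarith) h
    refine le_trans (le_of_eq ?_) this
    rw [targetIndex, if_pos hk1, Fintype.card_piFinset_const, Finset.card_range,
      ← pow_mul, sourceExp, if_neg (by omega), Nat.add_sub_cancel, mul_comm]

/-- The growth of the layers: the number of available walks exceeds the inverse hitting probability
`L ^ ((d - 1) * gridExp d k)` of a target by a factor `L ^ 2`. -/
lemma gridExp_mul_add_two_le (hd : 2 ≤ d) (k : ℕ) :
    gridExp d k * (d - 1) + 2 ≤ sourceExp d k := by
  obtain ⟨e, rfl⟩ : ∃ e, d = e + 1 := ⟨d - 1, by omega⟩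
  rw [Nat.add_sub_cancel]
  rcases k with _ | k
  · have : gridExp (e + 1) 0 ≤ e + 2 := min_le_left _ _
    simp only [sourceExp, if_true]
    nlinarith
  · have h1 : gridExp (e + 1) (k + 1) ≤ gridExp (e + 1) k + 1 := by
      unfold gridExp; omega
    have h2 : e + 2 ≤ gridExp (e + 1) k := by
      unfold gridExp
      refine le_min (by omega) ?_
      unfold outerExp
      nlinarith
    rw [sourceExp, if_neg (by omega), Nat.add_sub_cancel]
    nlinarith

end frogLayer

/-! ### The tail of the passage time -/

universe u

/-- One stage of the exploration: from a good set of sites in one layer, all the targets of the next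
layer are hit, except with small probability. -/
lemma exists_real_not_isGoodLayer_le {d : ℕ} (hd : 2 ≤ d) :
    ∃ c : ℝ, 0 < c ∧ ∃ T : ℕ, 1 ≤ T ∧ ∀ (i₀ : Fin d) (x₀ : Fin d → ℤ) (L : ℕ), 1 ≤ L →
      (∀ i, |x₀ i| ≤ L) → ∀ (Ω : Type u) [MeasurableSpace Ω] (μ : Measure Ω)
        [IsProbabilityMeasure μ] (S : (Fin d → ℤ) → ℕ → Ω → (Fin d → ℤ)), IsFrogFamily μ S →
      ∀ k ≤ lastGrid d + 1, ∀ W ⊆ frogLayer i₀ x₀ L (k + 1), IsGoodLayer i₀ x₀ L (k + 1) W →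
        μ.real {ω | ¬ IsGoodLayer i₀ x₀ L (k + 2) (nextVisited S
          (T * L ^ (outerExp d * (d + 1))) (frogLayer i₀ x₀ L (k + 2)) W ω)} ≤
          (L : ℝ) ^ (outerExp d * d) * Real.exp (-(c * (L : ℝ) ^ 2)) := by
  obtain ⟨c, C, hc, hC, hhit⟩ := le_hitProb_latticeBall hd
  have hd0 : 0 < d := by omega
  set F : ℕ := 2 * d * boxFactor d with hF
  have hF1 : 1 ≤ F := Nat.one_le_iff_ne_zero.2 (by positivity)
  refine ⟨c / (F : ℝ) ^ (d - 1), by positivity, ⌈C * (F : ℝ) ^ (d + 1)⌉₊ + 1, by omega, ?_⟩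
  intro i₀ x₀ L hL hx₀ Ω _ μ _ S hS k hk W hW hgood
  set N : ℕ := (⌈C * (F : ℝ) ^ (d + 1)⌉₊ + 1) * L ^ (outerExp d * (d + 1)) with hN
  have hL0 : (0 : ℝ) < L := by exact_mod_cast hL
  have hL1 : (1 : ℝ) ≤ L := by exact_mod_cast hL
  have hNle : C * ((F * L ^ outerExp d : ℕ) : ℝ) ^ (d + 1) ≤ N := by
    rw [hN]
    push_cast
    rw [mul_pow, ← pow_mul, ← mul_assoc]
    refine mul_le_mul_of_nonneg_right ?_ (by positivity)
    linarith [Nat.le_ceil (C * (F : ℝ) ^ (d + 1))]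
  have hp : c * ((targetRadius d L k : ℝ) / ((F * L ^ outerExp d : ℕ) : ℝ)) ^ (d - 1) =
      c / (F : ℝ) ^ (d - 1) / (L : ℝ) ^ (gridExp d k * (d - 1)) := by
    have h1 : ((L : ℝ) ^ outerExp d) = targetRadius d L k * (L : ℝ) ^ gridExp d k := by
      exact_mod_cast (targetRadius_mul d L k).symm
    have h2 : (0 : ℝ) < targetRadius d L k := by exact_mod_cast one_le_targetRadius hL k
    push_cast
    rw [h1, pow_mul]
    have : (targetRadius d L k : ℝ) / (F * (targetRadius d L k * (L : ℝ) ^ gridExp d k))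
        = 1 / F / (L : ℝ) ^ gridExp d k := by field_simp
    rw [this, div_pow, div_pow, one_pow]
    field_simp
  refine (hS.real_not_forall_hit_le (targetIndex d L k)
    (fun j => latticeBall (targetCentre i₀ x₀ L k j) (targetRadius d L k)) (N := N)
    (p := c * ((targetRadius d L k : ℝ) / ((F * L ^ outerExp d : ℕ) : ℝ)) ^ (d - 1))
    (M := (L : ℝ) ^ sourceExp d k) (by positivity) ?_ ?_ ?_).trans ?_
  · exact fun j hj x hx => mem_frogLayer_add_two.2 ⟨j, hj, hx⟩
  · exact_mod_cast le_card_of_isGoodLayer hk hgood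
  · intro y hy j hj
    refine hhit _ _ _ _ (one_le_targetRadius hL k)
      ((targetRadius_le hL k).trans (Nat.le_mul_of_pos_left _ hF1)) ?_ N hNle
    refine (latticeNormSq_sub_le hd0 (abs_le_of_mem_frogLayer hL hk (hW hy))
      (abs_targetCentre_le hL hx₀ hj)).trans (le_of_eq ?_)
    rw [hF]; push_cast; ring
  · refine mul_le_mul ?_ (Real.exp_le_exp.2 (neg_le_neg ?_)) (Real.exp_pos _).le (by positivity)
    · exact_mod_cast card_targetIndex_le hL k
    · have h1 : (L : ℝ) ^ (gridExp d k * (d - 1)) * (L : ℝ) ^ 2 ≤ (L : ℝ) ^ sourceExp d k := by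
        rw [← pow_add]
        exact pow_le_pow_right₀ hL1 (gridExp_mul_add_two_le hd k)
      rw [hp]
      calc c / (F : ℝ) ^ (d - 1) * (L : ℝ) ^ 2
          = c / (F : ℝ) ^ (d - 1) / (L : ℝ) ^ (gridExp d k * (d - 1)) *
            ((L : ℝ) ^ (gridExp d k * (d - 1)) * (L : ℝ) ^ 2) := by field_simp
        _ ≤ _ := mul_le_mul_of_nonneg_left h1 (by positivity)

/-- The tail bound along the scales: after time `L ^ P` the site `x₀` has been reached except with
probability of order `exp (-L)`. -/
lemma exists_real_le_passageTime_le {d : ℕ} (hd : 2 ≤ d) :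
    ∃ P : ℕ, 1 ≤ P ∧ ∃ C : ℝ, 0 < C ∧ ∀ x₀ : Fin d → ℤ, ∃ L₀ : ℕ, ∀ L ≥ L₀, ∀ n ≥ L ^ P,
      ∀ (Ω : Type u) [MeasurableSpace Ω] (μ : Measure Ω) [IsProbabilityMeasure μ]
        (S : (Fin d → ℤ) → ℕ → Ω → (Fin d → ℤ)), IsFrogFamily μ S →
        μ.real {ω | (n : ℕ∞) ≤ passageTime S 0 x₀ ω} ≤ C * Real.exp (-L) := by
  obtain ⟨c, hc, T, hT, hstage⟩ := exists_real_not_isGoodLayer_le.{u} hd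
  set A := outerExp d with hA
  set K := lastGrid d + 3 with hK
  refine ⟨A * (d + 1) + 1, by omega, 2 + (K - 1 : ℕ) * ((A * d).factorial : ℝ), by positivity, ?_⟩
  intro x₀
  refine ⟨2 * d + ⌈2 / c⌉₊ + (∑ i, (x₀ i).natAbs) + K * T + 1, ?_⟩
  intro L hL n hn Ω _ μ _ S hS
  have hL1 : 1 ≤ L := by omega
  have hLr : (1 : ℝ) ≤ L := by exact_mod_cast hL1
  have hx₀ : ∀ i, |x₀ i| ≤ L := by
    intro i
    have : (x₀ i).natAbs ≤ ∑ i, (x₀ i).natAbs :=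
      Finset.single_le_sum (f := fun i => (x₀ i).natAbs) (fun _ _ => Nat.zero_le _)
        (Finset.mem_univ i)
    rw [Int.abs_eq_natAbs]
    omega
  set N : ℕ := T * L ^ (A * (d + 1)) with hN
  set i₀ : Fin d := ⟨0, by omega⟩
  set δ : ℕ → ℝ := fun k => if k = 0 then 2 * Real.exp (-L)
    else (A * d).factorial * Real.exp (-L) with hδ
  have key := hS.real_not_visitedLayer_le (N := N) (D := frogLayer i₀ x₀ L) rfl (K := K)
    (fun k hk i hi => disjoint_frogLayer hL1 hk hi) (IsGoodLayer i₀ x₀ L) rfl δ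
    (fun k => by simp only [hδ]; split_ifs <;> positivity) ?_
  · have hsum : ∑ k ∈ Finset.range K, δ k =
        (2 + (K - 1 : ℕ) * ((A * d).factorial : ℝ)) * Real.exp (-L) := by
      obtain ⟨m, hm⟩ : ∃ m, K = m + 1 := ⟨K - 1, by omega⟩
      rw [hm, Finset.sum_range_succ']
      simp [hδ]
      ring
    rw [hsum] at key
    have hsub : {ω | (n : ℕ∞) ≤ passageTime S 0 x₀ ω} ⊆
        {ω | ¬ IsGoodLayer i₀ x₀ L K (visitedLayer S N (frogLayer i₀ x₀ L) K ω)} := ?_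
    · exact (measureReal_mono hsub (measure_ne_top _ _)).trans key
    intro ω hω hgood
    have hlast : ¬ lastGrid d + 1 ≤ lastGrid d := by omega
    obtain ⟨x, hxV, hx⟩ := hgood 0 (by simp [targetIndex])
    have hxx : x = x₀ := by
      have h1 : targetRadius d L (lastGrid d + 1) = 1 := by
        rw [targetRadius, gridExp_eq_outerExp (by omega)]; simp
      rw [h1] at hx
      ext i
      have h2 := abs_sub_lt_of_mem_latticeBall hx i
      simp only [targetCentre, if_neg hlast] at h2
      rw [Nat.cast_one, Int.abs_lt_one_iff] at h2
      omega
    have h3 := passageTime_le_of_mem_visitedLayer hxV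
    rw [hxx] at h3
    have h4 : n ≤ K * N := by
      have h5 : (n : ℕ∞) ≤ (K * N : ℕ) := le_trans hω h3
      exact_mod_cast h5
    have h6 : K * N < L ^ (A * (d + 1) + 1) := by
      rw [hN, pow_succ', ← mul_assoc]
      exact Nat.mul_lt_mul_of_pos_right (by omega) (by positivity)
    omega
  · intro k hk W hW hgood
    rcases k with _ | k
    · have hW0 : W = {0} := hgood
      subst hW0
      have hrN : L ^ A ≤ N := by
        rw [hN]
        calc L ^ A ≤ L ^ (A * (d + 1)) :=
              Nat.pow_le_pow_right hL1 (Nat.le_mul_of_pos_right _ (by omega))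
          _ ≤ _ := Nat.le_mul_of_pos_left _ hT
      refine (hS.real_not_slab_le (by omega) i₀ (ρ := L ^ (d ^ 2 + 1)) (r := L ^ A)
        (Nat.one_le_pow _ _ hL1) hrN (fun x h1 h2 h3 => ?_)).trans ?_
      · exact mem_frogLayer_one.2 ⟨by simpa using h1, h2, by simpa using h3⟩
      · simp only [hδ, if_true]
        refine mul_le_mul_of_nonneg_left (Real.exp_le_exp.2 (neg_le_neg ?_)) (by norm_num)
        have h2d : 2 * (d : ℝ) ≤ L := by
          have : 2 * d ≤ L := by omega
          exact_mod_cast this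
        rw [le_div_iff₀ (by positivity)]
        push_cast
        rw [hA, outerExp, ← pow_mul]
        calc (L : ℝ) * (2 * d * (L : ℝ) ^ ((d ^ 2 + 1) * 2))
            ≤ L * (L * (L : ℝ) ^ ((d ^ 2 + 1) * 2)) := by gcongr
          _ = (L : ℝ) ^ ((d ^ 2 + 1) * 2 + 2) := by ring
          _ ≤ _ := pow_le_pow_right₀ hLr (by nlinarith)
    · refine (hstage i₀ x₀ L hL1 hx₀ Ω μ S hS k (by omega) W hW hgood).trans ?_
      simp only [hδ, if_neg (Nat.succ_ne_zero k)]
      have hcL : 2 ≤ c * L := by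
        have h1 : (⌈2 / c⌉₊ : ℝ) ≤ L := by exact_mod_cast (by omega : ⌈2 / c⌉₊ ≤ L)
        have h2 := (Nat.le_ceil (2 / c)).trans h1
        rw [div_le_iff₀ hc] at h2
        linarith
      have h1 : (L : ℝ) ^ (A * d) ≤ (A * d).factorial * Real.exp L := by
        have := Real.pow_div_factorial_le_exp (L : ℝ) (by positivity) (A * d)
        rw [div_le_iff₀ (by positivity)] at this
        linarith
      calc (L : ℝ) ^ (A * d) * Real.exp (-(c * (L : ℝ) ^ 2))
          ≤ ((A * d).factorial * Real.exp L) * Real.exp (-(2 * L)) := by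
            refine mul_le_mul h1 (Real.exp_le_exp.2 (neg_le_neg ?_)) (Real.exp_pos _).le
              (by positivity)
            nlinarith
        _ = (A * d).factorial * Real.exp (-L) := by
            rw [mul_assoc, ← Real.exp_add]; congr 2; ring

theorem theorem4 (d : ℕ) (hd : 2 ≤ d) :
    ∃ γ : ℝ, 0 < γ ∧ ∀ x₀ : Fin d → ℤ, ∃ C : ℝ, 0 < C ∧
      ∀ (Ω : Type*) [MeasurableSpace Ω] (μ : Measure Ω) [IsProbabilityMeasure μ]
        (S : (Fin d → ℤ) → ℕ → Ω → (Fin d → ℤ)), IsFrogFamily μ S →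
        ∀ n : ℕ, μ.real {ω | (n : ℕ∞) ≤ passageTime S 0 x₀ ω} ≤
          C * Real.exp (-(n : ℝ) ^ γ) := by
  obtain ⟨P, hP, C, hC, h⟩ := exists_real_le_passageTime_le hd
  have hP0 : (0 : ℝ) < P := by exact_mod_cast hP
  refine ⟨1 / P, by positivity, fun x₀ => ?_⟩
  obtain ⟨L₀, hL₀⟩ := h x₀
  refine ⟨C * Real.exp 1 + Real.exp L₀, by positivity, ?_⟩
  intro Ω _ μ _ S hS n
  -- the largest scale `L` with `L ^ P ≤ n`
  set L : ℕ := ⌊(n : ℝ) ^ (1 / (P : ℝ))⌋₊ with hL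
  have hroot : (0 : ℝ) ≤ (n : ℝ) ^ (1 / (P : ℝ)) := by positivity
  have hlt : (n : ℝ) ^ (1 / (P : ℝ)) < L + 1 := Nat.lt_floor_add_one _
  rw [add_mul]
  by_cases hcase : L₀ ≤ L
  · have hLP : L ^ P ≤ n := by
      have h1 : (L : ℝ) ^ P ≤ ((n : ℝ) ^ (1 / (P : ℝ))) ^ P :=
        pow_le_pow_left₀ (by positivity) (Nat.floor_le hroot) P
      rw [one_div, Real.rpow_inv_natCast_pow (by positivity) (by omega)] at h1
      exact_mod_cast h1
    refine (hL₀ L hcase n hLP Ω μ S hS).trans ?_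
    have h2 : Real.exp (-L) ≤ Real.exp 1 * Real.exp (-(n : ℝ) ^ (1 / (P : ℝ))) := by
      rw [← Real.exp_add]
      exact Real.exp_le_exp.2 (by linarith)
    have h3 := mul_le_mul_of_nonneg_left h2 hC.le
    have h4 : 0 ≤ Real.exp L₀ * Real.exp (-(n : ℝ) ^ (1 / (P : ℝ))) := by positivity
    linarith
  · push Not at hcase
    have h1 : (n : ℝ) ^ (1 / (P : ℝ)) ≤ L₀ := by
      have : (L : ℝ) + 1 ≤ L₀ := by exact_mod_cast hcase
      linarith
    have h2 : (1 : ℝ) ≤ Real.exp L₀ * Real.exp (-(n : ℝ) ^ (1 / (P : ℝ))) := by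
      rw [← Real.exp_add]
      exact Real.one_le_exp (by linarith)
    have h3 : 0 ≤ C * Real.exp 1 * Real.exp (-(n : ℝ) ^ (1 / (P : ℝ))) := by positivity
    linarith [measureReal_le_one (μ := μ) (s := {ω | (n : ℕ∞) ≤ passageTime S 0 x₀ ω})]
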